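/- **Setting.** There are finitely many variables $X_i$; each variable $i$ has a finite set of possible values. An *element* is a pair $(i,j)$ with $j$ a value of $i$, and $\mathcal X$ is the set of all elements. For $Y,Y'\subseteq\mathcal X$ write $Y\sim i$ if $(i,j)\in Y$ for some $j$, and $Y\sim Y'$ if $Y\sim i$ and $Y'\sim i$ for some $i$. Call $Y$ *consistent* if it does not contain two different values of one variable. Let $\mathcal B$ be a finite collection of consistent sets $B\subseteq\mathcal X$ (the bad-events; $B$ is *true* if $X_i=j$ for all $(i,j)\in B$), let $\mathcal L:\mathcal B\to\{1,\dots,K\}$ be a labeling, and let $\mathcal B_k=\mathcal L^{-1}(k)$. For each $k$ let $Q_k:2^{\mathcal X}\to[0,1]$ be a fractional hitting set for $\mathcal B_k$, i.e. $\sum_{Y\subseteq B}Q_k(Y)\ge 1$ for all $B\in\mathcal B_k$, with $Q_k(Y)=0$ for every $Y$ that is not consistent. Write $Y\bowtie_k Y'$ if $Y\not\sim Y'$ and $Y,Y'\subseteq B$ for some $B\in\mathcal B_k$. **Parameters.** Let $\lambda_{i,j}\ge 0$ for $(i,j)\in\mathcal X$, $\lambda_i=\sum_j\lambda_{i,j}$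 and $\lambda^Y=\prod_{(i,j)\in Y}\lambda_{i,j}$. Put $$G_{i,j}(Q_k)=\sum_{Y\ni(i,j)}Q_k(Y)\lambda^Y,\quad G_i(Q_k)=\sum_{Y\sim i}Q_k(Y)\lambda^Y,\quad G(Q_k)=\sum_{Y\subseteq\mathcal X}Q_k(Y)\lambda^Y,$$ $$S_k=\max_{Y:\,Q_k(Y)>0}\ \sum_{Y'\bowtie_k Y}Q_k(Y')\lambda^{Y'}\ (\text{and } S_k=0 \text{ if } Q_k=0),\quad H_{i,j}=\sum_k\frac{G_{i,j}(Q_k)}{1-S_k},\quad H_i=\sum_jH_{i,j}.$$ Suppose that at least one of the following holds: (a) $S_k<1$ for all $k$, and $\lambda_i\ge 1+\sum_k\frac{G_i(Q_k)}{1-S_k}$ for all $i$; (b) $G(Q_k)<1$ for all $k$, and $\lambda_i\ge 1+\sum_k\frac{G_i(Q_k)}{1-G(Q_k)}$ for all $i$; (c) $Y\not\bowtie_k Y'$ whenever $Q_k(Y)>0$ and $Q_k(Y')>0$, and $\lambda_i\ge 1+\sum_kG_i(Q_k)$ for all $i$. **Algorithm.** The partial resampling algorithm (PRA) with $p_{i,j}=\lambda_{i,j}/\lambda_i$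 first draws all variables independently, with $P(X_i=j)=p_{i,j}$. As long as some bad-event is true, it chooses a true bad-event $B\in\mathcal B$ by an arbitrary rule (which may depend on the whole past of the execution and may be randomized), selects one subset $Y\subseteq B$ with probability $Q_k(Y)/\sum_{Y'\subseteq B}Q_k(Y')$, where $k=\mathcal L(B)$, and independently redraws the variables $i\sim Y$ according to $p$. It terminates when no bad-event is true. **Theorem.** For every rule for choosing the true bad-events, every variable $i$ and every set $J$ of values of $i$, $$\frac{\sum_{j\in J}\lambda_{i,j}-\sum_{j\in J}H_{i,j}}{\lambda_i-\sum_{j\in J}H_{i,j}}\ \le\ P(\text{the PRA terminates with }X_i\in J)\ \le\ \frac{\sum_{j\in J}\lambda_{i,j}}{\lambda_i-H_i+\sum_{j\in J}H_{i,j}}.$$ -/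

import Mathlib

open scoped ENNReal BigOperators

namespace PRA

universe u v

variable {ι : Type u} [Fintype ι] [DecidableEq ι]
variable {A : ι → Type v} [∀ i, Fintype (A i)] [∀ i, DecidableEq (A i)] {K : ℕ}

/-- An element is a pair `(i, j)` where `j` is one of the possible values of the variable `i`. -/
abbrev Elem {ι : Type u} (A : ι → Type v) : Type (max u v) := Σ i, A i

/-- A configuration assigns a value to every variable. -/
abbrev Config {ι : Type u} (A : ι → Type v) : Type (max u v) := ∀ i, A i

/-- `Y` does not contain two different values of the same variable. -/
def Consistent {ι : Type u} {A : ι → Type v} (Y : Finset (Elem A)) : Prop :=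
  ∀ (i : ι) (j j' : A i), (⟨i, j⟩ : Elem A) ∈ Y → (⟨i, j'⟩ : Elem A) ∈ Y → j = j'

/-- `Y` involves the variable `i`, that is, `i ∼ Y`. -/
def Involves {ι : Type u} {A : ι → Type v} (Y : Finset (Elem A)) (i : ι) : Prop :=
  ∃ j : A i, (⟨i, j⟩ : Elem A) ∈ Y

/-- `Y ∼ Y'`: the two sets of elements overlap in a variable. -/
def Overlap {ι : Type u} {A : ι → Type v} (Y Y' : Finset (Elem A)) : Prop :=
  ∃ i, Involves Y i ∧ Involves Y' i

/-- The atomic event `Y` is true in the configuration `x`. -/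
def Holds {ι : Type u} {A : ι → Type v} (Y : Finset (Elem A)) (x : Config A) : Prop :=
  ∀ e ∈ Y, x e.1 = e.2

/-- The combinatorial data of the partial resampling algorithm: a finite collection of atomic
bad-events, labels in a set of size `K`, and for each label `k` a fractional hitting set `Q k` for
the bad-events with label `k`. -/
structure Instance {ι : Type u} (A : ι → Type v) (K : ℕ) where
  /-- the bad-events -/
  bad : Finset (Finset (Elem A))
  /-- no bad-event contains two values of one variable -/
  bad_consistent : ∀ B ∈ bad, Consistent B
  /-- the labels of the bad-events -/
  label : bad → Fin K
  /-- the weights of the fractional hitting sets -/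
  Q : Fin K → Finset (Elem A) → ℝ
  Q_nonneg : ∀ k Y, 0 ≤ Q k Y
  Q_le_one : ∀ k Y, Q k Y ≤ 1
  /-- `Q k` vanishes on sets that contain two values of one variable -/
  Q_consistent : ∀ k Y, ¬ Consistent Y → Q k Y = 0
  /-- `Q k` is a fractional hitting set for the bad-events with label `k` -/
  Q_hitting : ∀ B : bad, 1 ≤ ∑ Y ∈ B.1.powerset, Q (label B) Y

/-! ### The algorithm -/

/-- The product distribution: the variables are independent and the variable `i` has law `p i`. -/
noncomputable def productPMF (p : ∀ i, PMF (A i)) : PMF (Config A) :=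
  PMF.ofFintype (fun x => ∏ i, p i (x i)) (by
    rw [← Fintype.prod_sum (fun i j => p i j)]
    refine Finset.prod_eq_one fun i _ => ?_
    simpa [tsum_fintype] using (p i).tsum_coe)

open Classical in
/-- Resample, independently and according to `p`, the variables involved in `Y`; the other
variables keep the values that they have in `x`. -/
noncomputable def resample (p : ∀ i, PMF (A i)) (Y : Finset (Elem A)) (x : Config A) :
    PMF (Config A) :=
  (productPMF p).map fun z i => if Involves Y i then z i else x i

open Classical in
/-- The random choice of the resampled set: the subset `Y` of the violated set `B` (with label `k`)
has probability `Q k Y / ∑ Y' ⊆ B, Q k Y'`. -/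
noncomputable def Instance.selectPMF {ι : Type u} {A : ι → Type v} (I : Instance A K)
    (B : I.bad) : PMF (Finset (Elem A)) :=
  PMF.ofFinset
    (fun Y => if Y ⊆ B.1 then
      ENNReal.ofReal (I.Q (I.label B) Y / ∑ Y' ∈ B.1.powerset, I.Q (I.label B) Y') else 0)
    B.1.powerset
    (by
      have h1 := I.Q_hitting B
      rw [Finset.sum_congr rfl fun Y hY => if_pos (Finset.mem_powerset.1 hY),
        ← ENNReal.ofReal_sum_of_nonneg fun Y _ =>
          div_nonneg (I.Q_nonneg _ _) (le_trans zero_le_one h1),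
        ← Finset.sum_div, div_self (by linarith), ENNReal.ofReal_one])
    (fun Y hY => if_neg fun h => hY (Finset.mem_powerset.2 h))

/-- The complete record of an execution: the initial configuration, and for every round the
violated set `B`, the resampled set `Y` and the configuration after the round. -/
inductive History {ι : Type u} (A : ι → Type v) : Type (max u v)
  | init (x : Config A) : History A
  | round (h : History A) (B Y : Finset (Elem A)) (x : Config A) : History A

/-- The configuration at the end of a history. -/
def History.current {ι : Type u} {A : ι → Type v} : History A → Config A
  | .init x => x
  | .round _ _ _ x => x

/-- Some bad-event is true, so that the algorithm has to go on. -/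
def Instance.Running {ι : Type u} {A : ι → Type v} (I : Instance A K) (h : History A) : Prop :=
  ∃ B ∈ I.bad, Holds B h.current

/-- A rule for the arbitrary choice of a true bad-event. The rule may depend on the whole history
and may be randomized. -/
def Instance.Strategy {ι : Type u} {A : ι → Type v} (I : Instance A K) : Type (max u v) :=
  ∀ h : History A, I.Running h → PMF {B : I.bad // Holds B.1 h.current}

open Classical in
/-- One round of the algorithm (nothing happens after it has terminated). -/
noncomputable def Instance.next (I : Instance A K) (p : ∀ i, PMF (A i)) (σ : I.Strategy)
    (h : History A) : PMF (History A) :=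
  if hr : I.Running h then
    (σ h hr).bind fun B =>
      (I.selectPMF B.1).bind fun Y =>
        (resample p Y h.current).map fun x => History.round h B.1.1 Y x
  else PMF.pure h

/-- The law of the history of the algorithm after (at most) `t` rounds. -/
noncomputable def Instance.run (I : Instance A K) (p : ∀ i, PMF (A i)) (σ : I.Strategy) :
    ℕ → PMF (History A)
  | 0 => (productPMF p).map History.init
  | t + 1 => (I.run p σ t).bind (I.next p σ)

/-- The probability that the algorithm terminates within `t` rounds and that its output is in
`E`. -/
noncomputable def Instance.outputProbWithin (I : Instance A K) (p : ∀ i, PMF (A i))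
    (σ : I.Strategy) (E : Set (Config A)) (t : ℕ) : ℝ≥0∞ :=
  (I.run p σ t).toOuterMeasure {h | ¬ I.Running h ∧ h.current ∈ E}

/-- The probability that the algorithm terminates with an output in `E`: the event is the
increasing union over `t` of the events that it does so within `t` rounds. -/
noncomputable def Instance.outputProb (I : Instance A K) (p : ∀ i, PMF (A i))
    (σ : I.Strategy) (E : Set (Config A)) : ℝ≥0∞ :=
  ⨆ t, I.outputProbWithin p σ E t

/-! ### The parameters that depend on `λ` -/

/-- `λ ^ Y = ∏ (i, j) ∈ Y, λ i j`. -/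
def lamPow {ι : Type u} {A : ι → Type v} (lam : ∀ i, A i → ℝ) (Y : Finset (Elem A)) : ℝ :=
  ∏ e ∈ Y, lam e.1 e.2

/-- `λ i = ∑ j, λ i j`. -/
def lamSum {ι : Type u} {A : ι → Type v} [∀ i, Fintype (A i)] (lam : ∀ i, A i → ℝ) (i : ι) : ℝ :=
  ∑ j, lam i j

/-- `Y ⋈ₖ Y'`: the two sets do not overlap in a variable, and they are contained in a common
bad-event with label `k`. -/
def Instance.Bowtie {ι : Type u} {A : ι → Type v} (I : Instance A K) (k : Fin K)
    (Y Y' : Finset (Elem A)) : Prop :=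
  ¬ Overlap Y Y' ∧ ∃ B : I.bad, I.label B = k ∧ Y ⊆ B.1 ∧ Y' ⊆ B.1

open Classical in
/-- `G i j = ∑ Y ∋ (i, j), Q Y * λ ^ Y`. -/
noncomputable def Gelem (Q : Finset (Elem A) → ℝ) (lam : ∀ i, A i → ℝ) (i : ι) (j : A i) : ℝ :=
  ∑ Y : Finset (Elem A) with (⟨i, j⟩ : Elem A) ∈ Y, Q Y * lamPow lam Y

open Classical in
/-- `G i = ∑ Y ∼ i, Q Y * λ ^ Y`. -/
noncomputable def Gvar (Q : Finset (Elem A) → ℝ) (lam : ∀ i, A i → ℝ) (i : ι) : ℝ :=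
  ∑ Y : Finset (Elem A) with Involves Y i, Q Y * lamPow lam Y

/-- `G = ∑ Y, Q Y * λ ^ Y`. -/
noncomputable def Gtotal (Q : Finset (Elem A) → ℝ) (lam : ∀ i, A i → ℝ) : ℝ :=
  ∑ Y : Finset (Elem A), Q Y * lamPow lam Y

open Classical in
/-- `S k` is the maximum, over the sets `Y` with `Q k Y > 0`, of the sum of `Q k Y' * λ ^ Y'` over
all `Y' ⋈ₖ Y` (and `0` if there is no such `Y`). -/
noncomputable def Instance.S (I : Instance A K) (lam : ∀ i, A i → ℝ) (k : Fin K) : ℝ :=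
  ⨆ Y : {Y : Finset (Elem A) // 0 < I.Q k Y},
    ∑ Y' : Finset (Elem A) with I.Bowtie k Y' Y.1, I.Q k Y' * lamPow lam Y'

/-- `H i j = ∑ k, G i j (Q k, λ) / (1 - S k)`. -/
noncomputable def Instance.H (I : Instance A K) (lam : ∀ i, A i → ℝ) (i : ι) (j : A i) : ℝ :=
  ∑ k, Gelem (I.Q k) lam i j / (1 - I.S lam k)

/-- `H i = ∑ j, H i j`. -/
noncomputable def Instance.Hsum (I : Instance A K) (lam : ∀ i, A i → ℝ) (i : ι) : ℝ :=
  ∑ j, I.H lam i j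

/-- First form of the convergence criterion. -/
def Instance.CriterionS (I : Instance A K) (lam : ∀ i, A i → ℝ) : Prop :=
  (∀ k, I.S lam k < 1) ∧
    ∀ i, 1 + ∑ k, Gvar (I.Q k) lam i / (1 - I.S lam k) ≤ lamSum lam i

/-- Second form of the convergence criterion. -/
def Instance.CriterionG (I : Instance A K) (lam : ∀ i, A i → ℝ) : Prop :=
  (∀ k, Gtotal (I.Q k) lam < 1) ∧
    ∀ i, 1 + ∑ k, Gvar (I.Q k) lam i / (1 - Gtotal (I.Q k) lam) ≤ lamSum lam i

/-- Third form of the convergence criterion: the relations `⋈ₖ` are null. -/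
def Instance.CriterionNull (I : Instance A K) (lam : ∀ i, A i → ℝ) : Prop :=
  (∀ k Y Y', 0 < I.Q k Y → 0 < I.Q k Y' → ¬ I.Bowtie k Y Y') ∧
    ∀ i, 1 + ∑ k, Gvar (I.Q k) lam i ≤ lamSum lam i

/-- The vector `λ` satisfies the convergence criterion in one of its three forms. -/
def Instance.Criterion (I : Instance A K) (lam : ∀ i, A i → ℝ) : Prop :=
  I.CriterionS lam ∨ I.CriterionG lam ∨ I.CriterionNull lam

end PRA

/-! Read an execution backwards from an event. A diagram starts with a root standing for the event;
each earlier resampled set is added, if possible, as deep as possible below a node with which it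
shares a variable or to which it is ⋈-related. Nodes at one depth then share no variable, so depth
orders the occurrences of each variable: the deepest occurrence concerns the current value, every
other one a fresh draw. This gives each diagram a weight depending on the current configuration, and
the potential of a root is the sum of the weights of all its diagrams.

In a round the resampled set is one of the subsets of a single bad-event, and any two of these
overlap or are ⋈-related. Hence an enlarged diagram determines both the added set and the diagram
before (`site_unique`), so a round cannot increase the expected potential; it even lowers it by the
probability that the root itself is resampled (`sum_expect_potential_le`, `round_le`). This holds
for every rule of choice.

At the start the expected potential is at most a sum over diagrams of products of node weights. A
tree recursion bounds it by any solution of a system of inequalities (`tsum_reach_le`). The function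
Q_k(Y) ∏ p_{i,j} ρ_i / (1 - S_k) is a solution whenever ρ_i is at least 1 plus the sum of its values
over the labelled sets Y ∼ i in use (`expect_potential_le`); ρ = λ works by the criterion.

Until X_i first lies in J, no true bad-event contains (i,j) with j ∈ J. Diagrams for this event may
avoid those elements, which allows the smaller ρ_i = λ_i / (λ_i - ∑_{j ∉ J} H_{i,j}); summing
p_{i,j} ρ_i over J is the upper bound. The lower bound is the upper bound for the complement of J
together with almost sure termination, because the expected number of rounds is at most the sum of
the potentials of all possible roots, which is finite. -/

namespace PRA

universe u v w

/-! ### Diagrams and the addition of nodes at maximal depth -/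

section Diagrams

variable {ι : Type u} {A : ι → Type v} {N : Type w}

/-- Abstract pieces: every node carries a set of elements and a weight; a predicate says which nodes
may be used below the root of a diagram, and the relation `bow` is a form of dependency between
nodes that need not overlap. -/
structure Pieces {ι : Type u} (A : ι → Type v) (N : Type w) where
  /-- the set of elements of a node -/
  el : N → Finset (Elem A)
  /-- the nodes that may be used below the root -/
  ok : N → Prop
  /-- the additional dependency between nodes -/
  bow : N → N → Prop
  /-- the weight of a node -/
  q : N → ℝ≥0∞

/-- The node `y` fits into the slot `s` of the node `v`. -/
def Pieces.Fits (D : Pieces A N) (s : Option ι) (v y : N) : Prop :=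
  D.ok y ∧ s.elim (D.bow y v) fun i => Involves (D.el v) i ∧ Involves (D.el y) i

/-- A diagram assigns nodes to finitely many paths; a path is a list of slots. -/
abbrev Diagram (ι : Type u) (N : Type w) : Type (max u w) := Finset (List (Option ι) × N)

/-- The path `π` is free, and `y` fits there. -/
def Pieces.Vacant (D : Pieces A N) (τ : Diagram ι N) (y : N) (π : List (Option ι)) : Prop :=
  ∃ ϖ s v, π = ϖ ++ [s] ∧ (ϖ, v) ∈ τ ∧ D.Fits s v y ∧ ∀ u, (π, u) ∉ τ

/-- A vacant path of maximal length. -/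
def Pieces.Site (D : Pieces A N) (τ : Diagram ι N) (y : N) (π : List (Option ι)) : Prop :=
  D.Vacant τ y π ∧ ∀ π', D.Vacant τ y π' → π'.length ≤ π.length

open Classical in
/-- The diagrams that arise from the root `r` by adding nodes at vacant paths of maximal length. -/
inductive Pieces.Reach (D : Pieces A N) (r : N) : Diagram ι N → Prop
  | root : D.Reach r {([], r)}
  | graft {τ : Diagram ι N} {y : N} {π : List (Option ι)} :
      D.Reach r τ → D.Site τ y π → D.Reach r (insert (π, y) τ)

variable {D : Pieces A N} {r y y' u v : N} {τ τ' : Diagram ι N} {π π' ϖ : List (Option ι)}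

theorem Pieces.Vacant.ne_nil (h : D.Vacant τ y π) : π ≠ [] := by
  obtain ⟨ϖ, s, v, rfl, -⟩ := h
  simp

theorem Pieces.Vacant.ok (h : D.Vacant τ y π) : D.ok y := by
  obtain ⟨ϖ, s, v, -, -, h, -⟩ := h
  exact h.1

theorem Pieces.Vacant.not_mem (h : D.Vacant τ y π) (u : N) : (π, u) ∉ τ := by
  obtain ⟨ϖ, s, v, -, -, -, h⟩ := h
  exact h u

theorem Pieces.exists_site [Finite ι] (h : ∃ π, D.Vacant τ y π) : ∃ π, D.Site τ y π := by
  have hfin : {π | D.Vacant τ y π}.Finite := by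
    refine ((τ.finite_toSet.prod (Set.finite_univ (α := Option ι))).image
      (fun z => z.1.1 ++ [z.2])).subset ?_
    rintro π ⟨ϖ, s, v, rfl, hv, -⟩
    exact ⟨((ϖ, v), s), ⟨by simpa using hv, trivial⟩, rfl⟩
  obtain ⟨π, hπ, hmax⟩ := Set.exists_max_image _ List.length hfin h
  exact ⟨π, hπ, hmax⟩

theorem Pieces.Reach.root_mem (h : D.Reach r τ) : ([], r) ∈ τ := by
  classical
  induction h with
  | root => simp
  | graft _ _ ih => simp [ih]

theorem Pieces.Reach.unique (h : D.Reach r τ) (hv : (π, v) ∈ τ) (hu : (π, u) ∈ τ) : v = u := by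
  classical
  induction h with
  | root => simp_all
  | graft _ hs ih =>
    rcases Finset.mem_insert.1 hv with hv' | hv' <;>
      rcases Finset.mem_insert.1 hu with hu' | hu'
    · simp_all
    · cases hv'; exact absurd hu' (hs.1.not_mem _)
    · cases hu'; exact absurd hv' (hs.1.not_mem _)
    · exact ih hv' hu'

theorem Pieces.Reach.parent (h : D.Reach r τ) {s : Option ι} (hy : (ϖ ++ [s], y) ∈ τ) :
    ∃ v, (ϖ, v) ∈ τ ∧ D.Fits s v y := by
  classical
  induction h with
  | root => simp at hy
  | graft _ hs ih =>
    rcases Finset.mem_insert.1 hy with hy | hy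
    · obtain ⟨⟨ϖ', s', v, he, hv, hf, -⟩, -⟩ := hs
      cases hy
      obtain ⟨rfl, h2⟩ := List.append_inj' he rfl
      cases h2
      exact ⟨v, Finset.mem_insert_of_mem hv, hf⟩
    · obtain ⟨v, hv, hf⟩ := ih hy
      exact ⟨v, Finset.mem_insert_of_mem hv, hf⟩

theorem Pieces.Reach.ok_or_eq (h : D.Reach r τ) (hv : (π, v) ∈ τ) : D.ok v ∨ v = r := by
  classical
  induction h with
  | root => simp_all
  | graft _ hs ih =>
    rcases Finset.mem_insert.1 hv with hv | hv
    · cases hv; exact .inl hs.1.ok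
    · exact ih hv

theorem Pieces.Reach.consistent (h : D.Reach r τ) (hcons : ∀ y, D.ok y → Consistent (D.el y))
    (hr : Consistent (D.el r)) : ∀ z ∈ τ, Consistent (D.el z.2) := by
  intro z hz
  rcases h.ok_or_eq (π := z.1) (v := z.2) hz with h1 | h1
  · exact hcons _ h1
  · exact h1 ▸ hr

/-- Below a deepest node involving `i` the slot `some i` must be free, since an occupant would
involve `i` at a greater depth. -/
theorem Pieces.Reach.exists_vacant_of_involves (h : D.Reach r τ) {i : ι} (hv : (π, v) ∈ τ)
    (hi : Involves (D.el v) i) (hy : D.ok y) (hyi : Involves (D.el y) i) :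
    ∃ π', D.Vacant τ y π' ∧ π.length < π'.length := by
  classical
  obtain ⟨⟨π₀, v₀⟩, h₀, hmax⟩ := Finset.exists_max_image
    {z ∈ τ | Involves (D.el z.2) i} (fun z => z.1.length) ⟨(π, v), by simp [hv, hi]⟩
  simp only [Finset.mem_filter] at h₀ hmax
  refine ⟨π₀ ++ [some i], ⟨π₀, some i, v₀, rfl, h₀.1, ⟨hy, h₀.2, hyi⟩, fun u hu => ?_⟩, ?_⟩
  · obtain ⟨w, -, hw⟩ := h.parent hu
    have := hmax _ ⟨hu, hw.2.2⟩
    simp at this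
  · have : π.length ≤ π₀.length := hmax _ ⟨hv, hi⟩
    simp only [List.length_append, List.length_singleton] at this ⊢
    omega

/-- Maximality of the site puts a new node strictly below every node with which it shares a
variable, so that depth records the order of the occurrences of each variable. -/
theorem Pieces.Reach.length_lt_of_site (h : D.Reach r τ) {i : ι} (hs : D.Site τ y π')
    (hv : (π, v) ∈ τ) (hi : Involves (D.el v) i) (hyi : Involves (D.el y) i) :
    π.length < π'.length := by
  obtain ⟨ϖ, h1, h2⟩ := h.exists_vacant_of_involves hv hi hs.1.ok hyi
  exact h2.trans_le (hs.2 _ h1)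

/-- Two nodes at the same depth do not overlap. -/
theorem Pieces.Reach.path_eq (h : D.Reach r τ) {i : ι} (hv : (π, v) ∈ τ) (hu : (π', u) ∈ τ)
    (hvi : Involves (D.el v) i) (hui : Involves (D.el u) i) (hl : π.length = π'.length) :
    π = π' := by
  classical
  induction h with
  | root => simp_all
  | graft h hs ih =>
    rcases Finset.mem_insert.1 hv with hv' | hv' <;>
      rcases Finset.mem_insert.1 hu with hu' | hu'
    · simp_all
    · cases hv'
      have := h.length_lt_of_site hs hu' hui hvi
      omega
    · cases hu'
      have := h.length_lt_of_site hs hv' hvi hui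
      omega
    · exact ih hv' hu'

/-- The two nodes overlap, or they are related by `bow`. -/
def Pieces.Dep (D : Pieces A N) (y v : N) : Prop := Overlap (D.el y) (D.el v) ∨ D.bow y v

theorem Pieces.exists_vacant_of_leaf (hv : (π, v) ∈ τ) (hleaf : ∀ s u, (π ++ [s], u) ∉ τ)
    (hy : D.ok y) (hd : D.Dep y v) : ∃ s, D.Vacant τ y (π ++ [s]) := by
  rcases hd with ⟨i, h1, h2⟩ | hb
  · exact ⟨some i, π, some i, v, rfl, hv, ⟨hy, h2, h1⟩, hleaf _⟩
  · exact ⟨none, π, none, v, rfl, hv, ⟨hy, hb⟩, hleaf _⟩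

theorem Pieces.Reach.leaf_of_site [DecidableEq (List (Option ι) × N)]
    (h : D.Reach r τ) (hs : D.Site τ y π) (s : Option ι) (u : N) :
    (π ++ [s], u) ∉ insert (π, y) τ := by
  intro hu
  rcases Finset.mem_insert.1 hu with hu | hu
  · simp at hu
  · obtain ⟨v, hv, -⟩ := h.parent hu
    exact hs.1.not_mem _ hv

/-- Two ways of obtaining the same diagram by adding mutually dependent nodes agree. -/
theorem Pieces.Reach.site_unique [DecidableEq (List (Option ι) × N)]
    (h : D.Reach r τ) (h' : D.Reach r τ')
    (hs : D.Site τ y π) (hs' : D.Site τ' y' π') (hd : D.Dep y y') (hd' : D.Dep y' y)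
    (he : insert (π, y) τ = insert (π', y') τ') : y = y' ∧ τ = τ' := by
  by_cases hp : π = π'
  · subst hp
    have hyy : y = y' := (Finset.mem_insert.1 (he ▸ Finset.mem_insert_self (π, y) τ)).elim
      (fun h => (Prod.ext_iff.1 h).2) fun h => absurd h (hs'.1.not_mem y)
    subst hyy
    refine ⟨rfl, ?_⟩
    rw [← Finset.erase_insert (hs.1.not_mem y), he, Finset.erase_insert (hs'.1.not_mem y)]
  -- Each of the two last additions is a leaf of the other diagram, so the other node could have
  -- gone directly below it. Maximality makes each path strictly longer than the other.
  · exfalso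
    have h1 : (π, y) ∈ τ' := by
      have : (π, y) ∈ insert (π', y') τ' := he ▸ Finset.mem_insert_self _ _
      exact (Finset.mem_insert.1 this).resolve_left fun h => hp (Prod.ext_iff.1 h).1
    have h2 : (π', y') ∈ τ := by
      have : (π', y') ∈ insert (π, y) τ := he ▸ Finset.mem_insert_self _ _
      exact (Finset.mem_insert.1 this).resolve_left fun h => hp (Prod.ext_iff.1 h).1.symm
    obtain ⟨s, h3⟩ := exists_vacant_of_leaf h1
      (fun s u hu => h.leaf_of_site hs s u (he ▸ Finset.mem_insert_of_mem hu)) hs'.1.ok hd'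
    obtain ⟨s', h4⟩ := exists_vacant_of_leaf h2
      (fun s u hu => h'.leaf_of_site hs' s u (he ▸ Finset.mem_insert_of_mem hu)) hs.1.ok hd
    have h5 := hs'.2 _ h3
    have h6 := hs.2 _ h4
    simp only [List.length_append, List.length_singleton] at h5 h6
    omega

open Classical in
/-- Add the node `y` at a vacant path of maximal length, if there is one. -/
noncomputable def Pieces.graft [Finite ι] (D : Pieces A N) (τ : Diagram ι N) (y : N) :
    Diagram ι N :=
  if h : ∃ π, D.Vacant τ y π then insert ((exists_site h).choose, y) τ else τ

theorem Pieces.exists_graft_eq [Finite ι] [DecidableEq (List (Option ι) × N)]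
    (h : ∃ π, D.Vacant τ y π) : ∃ π, D.Site τ y π ∧ D.graft τ y = insert (π, y) τ := by
  refine ⟨_, (exists_site h).choose_spec, ?_⟩
  rw [graft, dif_pos h]
  congr!

theorem Pieces.graft_eq_self [Finite ι] (h : ¬ ∃ π, D.Vacant τ y π) : D.graft τ y = τ :=
  dif_neg h

theorem Pieces.Reach.reach_graft [Finite ι] (h : D.Reach r τ) (y : N) :
    D.Reach r (D.graft τ y) := by
  unfold Pieces.graft
  split_ifs with hv
  · exact h.graft (exists_site hv).choose_spec
  · exact h

end Diagrams

/-! ### Expectations of nonnegative functions -/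

section Expectation

variable {α β : Type*}

/-- The expectation of a nonnegative function. -/
noncomputable def expect (μ : PMF α) (f : α → ℝ≥0∞) : ℝ≥0∞ := ∑' a, μ a * f a

theorem expect_pure (a : α) (f : α → ℝ≥0∞) : expect (PMF.pure a) f = f a := by
  classical
  unfold expect
  rw [tsum_eq_single a fun b hb => by simp [PMF.pure_apply, hb]]
  simp

theorem expect_bind (μ : PMF α) (κ : α → PMF β) (f : β → ℝ≥0∞) :
    expect (μ.bind κ) f = expect μ fun a => expect (κ a) f := by
  simp only [expect, PMF.bind_apply, ← ENNReal.tsum_mul_right, ← ENNReal.tsum_mul_left]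
  rw [ENNReal.tsum_comm]
  simp only [mul_assoc]

theorem expect_map (μ : PMF α) (g : α → β) (f : β → ℝ≥0∞) :
    expect (μ.map g) f = expect μ fun a => f (g a) := by
  rw [← PMF.bind_pure_comp, expect_bind]
  simp [expect_pure]

theorem expect_mono {μ : PMF α} {f g : α → ℝ≥0∞} (h : ∀ a, μ a ≠ 0 → f a ≤ g a) :
    expect μ f ≤ expect μ g := by
  refine ENNReal.tsum_le_tsum fun a => ?_
  by_cases ha : μ a = 0
  · simp [ha]
  · gcongr
    exact h a ha

theorem expect_const (μ : PMF α) (c : ℝ≥0∞) : expect μ (fun _ => c) = c := by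
  simp [expect, ENNReal.tsum_mul_right, μ.tsum_coe]

theorem expect_add (μ : PMF α) (f g : α → ℝ≥0∞) :
    expect μ (fun a => f a + g a) = expect μ f + expect μ g := by
  simp [expect, mul_add, ENNReal.tsum_add]

theorem expect_tsum (μ : PMF α) (f : β → α → ℝ≥0∞) :
    expect μ (fun a => ∑' b, f b a) = ∑' b, expect μ (f b) := by
  simp only [expect, ← ENNReal.tsum_mul_left]
  exact ENNReal.tsum_comm

theorem expect_sum {s : Finset β} (μ : PMF α) (f : β → α → ℝ≥0∞) :
    expect μ (fun a => ∑ b ∈ s, f b a) = ∑ b ∈ s, expect μ (f b) := by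
  simp only [expect, Finset.mul_sum]
  exact Summable.tsum_finsetSum fun _ _ => ENNReal.summable

theorem expect_mul_left (μ : PMF α) (c : ℝ≥0∞) (f : α → ℝ≥0∞) :
    expect μ (fun a => c * f a) = c * expect μ f := by
  simp only [expect, ← ENNReal.tsum_mul_left]
  exact tsum_congr fun a => mul_left_comm _ _ _

theorem toOuterMeasure_eq_expect (μ : PMF α) (s : Set α) :
    μ.toOuterMeasure s = expect μ (s.indicator 1) := by
  rw [PMF.toOuterMeasure_apply]
  refine tsum_congr fun a => ?_
  by_cases h : a ∈ s <;> simp [h]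

end Expectation

/-! ### Expectations of products of one-variable functions -/

section Product

variable {ι : Type u} [Fintype ι] [DecidableEq ι] {A : ι → Type v} [∀ i, Fintype (A i)]

theorem expect_productPMF (p : ∀ i, PMF (A i)) (h : ∀ i, A i → ℝ≥0∞) :
    expect (productPMF p) (fun z => ∏ i, h i (z i)) = ∏ i, ∑ a, p i a * h i a := by
  rw [Fintype.prod_sum (fun i a => p i a * h i a), expect, tsum_fintype]
  refine Finset.sum_congr rfl fun z _ => ?_
  rw [productPMF, PMF.ofFintype_apply, Finset.prod_mul_distrib]

open Classical in
theorem expect_resample (p : ∀ i, PMF (A i)) (Y : Finset (Elem A)) (x : Config A)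
    (h : ∀ i, A i → ℝ≥0∞) :
    expect (resample p Y x) (fun z => ∏ i, h i (z i)) =
      ∏ i, if Involves Y i then ∑ a, p i a * h i a else h i (x i) := by
  rw [resample, expect_map]
  refine (expect_productPMF p fun i a => h i (if Involves Y i then a else x i)).trans ?_
  refine Finset.prod_congr rfl fun i _ => ?_
  by_cases hi : Involves Y i
  · simp [hi]
  · have := (p i).tsum_coe
    rw [tsum_fintype] at this
    simp [hi, ← Finset.sum_mul, this]

end Product

/-! ### Values of one variable in a consistent set -/

section Filter

variable {ι : Type u} {A : ι → Type v} [∀ i, Fintype (A i)] {i : ι}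

theorem filter_eq_empty_of_not_involves {Y : Finset (Elem A)}
    [DecidablePred fun j => (⟨i, j⟩ : Elem A) ∈ Y] (h : ¬ Involves Y i) :
    ({j | (⟨i, j⟩ : Elem A) ∈ Y} : Finset (A i)) = ∅ :=
  Finset.filter_eq_empty_iff.2 fun j _ hj => h ⟨j, hj⟩

theorem Consistent.filter_eq_singleton {Y : Finset (Elem A)}
    [DecidablePred fun j => (⟨i, j⟩ : Elem A) ∈ Y] (h : Consistent Y) {j : A i}
    (hj : (⟨i, j⟩ : Elem A) ∈ Y) : ({j | (⟨i, j⟩ : Elem A) ∈ Y} : Finset (A i)) = {j} := by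
  ext j'
  simp only [Finset.mem_filter, Finset.mem_univ, true_and, Finset.mem_singleton]
  exact ⟨fun h' => h i _ _ h' hj, fun h' => h' ▸ hj⟩

end Filter

/-! ### Weights of diagrams -/

section Weight

variable {ι : Type u} [DecidableEq ι] {A : ι → Type v} [∀ i, Fintype (A i)]
  {N : Type w}

/-- Some node of `τ` below depth `n` involves the variable `i`. -/
def Pieces.Deeper (D : Pieces A N) (τ : Diagram ι N) (n : ℕ) (i : ι) : Prop :=
  ∃ z ∈ τ, n < z.1.length ∧ Involves (D.el z.2) i

open Classical in
/-- The probability that the occurrences of the variable `i` in `τ` happen, given that the current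
value of the variable is `a`: the deepest occurrence concerns the current value. -/
noncomputable def Pieces.varWeight (D : Pieces A N) (p : ∀ i, PMF (A i)) (τ : Diagram ι N) (i : ι)
    (a : A i) : ℝ≥0∞ :=
  ∏ z ∈ τ, ∏ j with (⟨i, j⟩ : Elem A) ∈ D.el z.2,
    if D.Deeper τ z.1.length i then p i j else if a = j then 1 else 0

open Classical in
/-- The probability that all occurrences of the variable `i` in `τ` happen. -/
noncomputable def Pieces.varMass (D : Pieces A N) (p : ∀ i, PMF (A i)) (τ : Diagram ι N)
    (i : ι) : ℝ≥0∞ :=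
  ∏ z ∈ τ, ∏ j with (⟨i, j⟩ : Elem A) ∈ D.el z.2, p i j

variable {D : Pieces A N} {p : ∀ i, PMF (A i)} {r y : N} {τ : Diagram ι N}
  {π : List (Option ι)} {x : Config A} {i : ι}

open Classical in
theorem Pieces.varWeight_of_not_involves (h : ∀ z ∈ τ, ¬ Involves (D.el z.2) i) (a : A i) :
    D.varWeight p τ i a = 1 := by
  refine Finset.prod_eq_one fun z hz => ?_
  rw [filter_eq_empty_of_not_involves (h z hz), Finset.prod_empty]

/-- Only one node carries an indicator: by `path_eq` the deepest node involving `i` is unique.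
Averaging over the current value turns this indicator into the missing factor `p i j₀`. -/
theorem Pieces.Reach.sum_varWeight_le (h : D.Reach r τ)
    (hcons : ∀ z ∈ τ, Consistent (D.el z.2)) :
    ∑ a, p i a * D.varWeight p τ i a ≤ D.varMass p τ i := by
  classical
  have hp : ∑ a, p i a = 1 := by rw [← (p i).tsum_coe, tsum_fintype]
  by_cases hi : ∃ z ∈ τ, Involves (D.el z.2) i
  · obtain ⟨⟨π₀, v₀⟩, h₀, hmax⟩ := Finset.exists_max_image
      {z ∈ τ | Involves (D.el z.2) i} (fun z => z.1.length)
      (hi.imp fun z hz => Finset.mem_filter.2 hz)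
    simp only [Finset.mem_filter] at h₀ hmax
    obtain ⟨h₀, j₀, hj₀⟩ := h₀
    have hnd : ¬ D.Deeper τ π₀.length i := by
      rintro ⟨z, hz, hlt, hzi⟩
      have := hmax z ⟨hz, hzi⟩
      omega
    have hw : ∀ a, D.varWeight p τ i a = (if a = j₀ then 1 else 0) *
        ∏ z ∈ τ.erase (π₀, v₀), ∏ j with (⟨i, j⟩ : Elem A) ∈ D.el z.2, p i j := by
      intro a
      rw [varWeight, ← Finset.mul_prod_erase _ _ h₀,
        (hcons _ h₀).filter_eq_singleton hj₀, Finset.prod_singleton, if_neg hnd]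
      congr 1
      refine Finset.prod_congr rfl fun z hz => Finset.prod_congr rfl fun j hj => if_pos ?_
      obtain ⟨hne, hz⟩ := Finset.mem_erase.1 hz
      have hzi : Involves (D.el z.2) i := ⟨j, (Finset.mem_filter.1 hj).2⟩
      refine ⟨_, h₀, lt_of_le_of_ne (hmax z ⟨hz, hzi⟩) fun he => hne ?_, ⟨j₀, hj₀⟩⟩
      have h1 : z.1 = π₀ := h.path_eq hz h₀ hzi ⟨j₀, hj₀⟩ he
      have h2 : (π₀, z.2) ∈ τ := h1 ▸ hz
      exact Prod.ext h1 (h.unique h2 h₀)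
    have hm : D.varMass p τ i = p i j₀ *
        ∏ z ∈ τ.erase (π₀, v₀), ∏ j with (⟨i, j⟩ : Elem A) ∈ D.el z.2, p i j := by
      rw [varMass, ← Finset.mul_prod_erase _ _ h₀,
        (hcons _ h₀).filter_eq_singleton hj₀, Finset.prod_singleton]
    simp only [hw, ← mul_assoc, ← Finset.sum_mul]
    rw [hm]
    simp
  · push Not at hi
    simp only [varWeight_of_not_involves hi, mul_one, hp]
    refine le_of_eq (Finset.prod_eq_one fun z hz => ?_).symm
    rw [filter_eq_empty_of_not_involves (hi z hz), Finset.prod_empty]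

open Classical in
-- The new node becomes the deepest one at `i`, so it takes over the indicator, which is 1 for the
-- value `j`; all older occurrences become fresh draws.
theorem Pieces.Reach.varWeight_insert [DecidableEq (List (Option ι) × N)]
    (h : D.Reach r τ) (hs : D.Site τ y π)
    {j : A i} (hcons : Consistent (D.el y)) (hj : (⟨i, j⟩ : Elem A) ∈ D.el y) :
    D.varWeight p (insert (π, y) τ) i j = D.varMass p τ i := by
  rw [varWeight, Finset.prod_insert (hs.1.not_mem y), hcons.filter_eq_singleton hj,
    Finset.prod_singleton, if_neg, if_pos rfl, one_mul, varMass]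
  · refine Finset.prod_congr rfl fun z hz => Finset.prod_congr rfl fun j' hj' => if_pos ?_
    exact ⟨_, Finset.mem_insert_self _ _,
      h.length_lt_of_site (v := z.2) hs hz ⟨j', (Finset.mem_filter.1 hj').2⟩ ⟨j, hj⟩, ⟨j, hj⟩⟩
  · rintro ⟨z, hz, hlt, hi⟩
    rcases Finset.mem_insert.1 hz with rfl | hz
    · exact lt_irrefl _ hlt
    · exact absurd (h.length_lt_of_site (v := z.2) hs hz hi ⟨j, hj⟩) (by simpa using hlt.le)

open Classical in
theorem Pieces.varWeight_insert_of_not_involves [DecidableEq (List (Option ι) × N)]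
    (hy : ¬ Involves (D.el y) i)
    (hπ : (π, y) ∉ τ) (a : A i) :
    D.varWeight p (insert (π, y) τ) i a = D.varWeight p τ i a := by
  have hd : ∀ n, D.Deeper (insert (π, y) τ) n i ↔ D.Deeper τ n i := by
    intro n
    constructor
    · rintro ⟨z, hz, hlt, hi⟩
      rcases Finset.mem_insert.1 hz with rfl | hz
      · exact absurd hi hy
      · exact ⟨z, hz, hlt, hi⟩
    · rintro ⟨z, hz, hlt⟩
      exact ⟨z, Finset.mem_insert_of_mem hz, hlt⟩
  rw [varWeight, Finset.prod_insert hπ, filter_eq_empty_of_not_involves hy, Finset.prod_empty,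
    one_mul, varWeight]
  simp only [hd]

variable [Fintype ι]

/-- The weight of the diagram `τ` given the current configuration `x`. -/
noncomputable def Pieces.weight (D : Pieces A N) (p : ∀ i, PMF (A i)) (τ : Diagram ι N)
    (x : Config A) : ℝ≥0∞ :=
  (∏ z ∈ τ, D.q z.2) * ∏ i, D.varWeight p τ i (x i)

/-- The total weight of all diagrams with root `r`. -/
noncomputable def Pieces.potential (D : Pieces A N) (p : ∀ i, PMF (A i)) (r : N)
    (x : Config A) : ℝ≥0∞ :=
  ∑' τ : {τ : Diagram ι N // D.Reach r τ}, D.weight p τ.1 x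

/-- Averaging the weight over the product distribution. -/
theorem Pieces.Reach.expect_weight_le (h : D.Reach r τ)
    (hcons : ∀ z ∈ τ, Consistent (D.el z.2)) :
    expect (productPMF p) (D.weight p τ) ≤ ∏ z ∈ τ, (D.q z.2 * ∏ e ∈ D.el z.2, p e.1 e.2) := by
  classical
  unfold Pieces.weight
  rw [expect_mul_left, expect_productPMF, Finset.prod_mul_distrib]
  gcongr
  refine (Finset.prod_le_prod' fun i _ => h.sum_varWeight_le hcons).trans ?_
  simp only [varMass]
  rw [Finset.prod_comm]
  refine le_of_eq (Finset.prod_congr rfl fun z _ => ?_)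
  rw [Finset.prod_sigma']
  refine Finset.prod_congr ?_ fun _ _ => rfl
  ext ⟨i, j⟩
  simp

/-- Resampling a true node produces the weight of the diagram with this node added. -/
theorem Pieces.Reach.expect_resample_weight_le [DecidableEq (List (Option ι) × N)]
    (h : D.Reach r τ) (hs : D.Site τ y π)
    (hcons : ∀ z ∈ τ, Consistent (D.el z.2)) (hy : Consistent (D.el y))
    (hx : Holds (D.el y) x) :
    D.q y * expect (resample p (D.el y) x) (D.weight p τ) ≤ D.weight p (insert (π, y) τ) x := by
  classical
  unfold Pieces.weight
  rw [expect_mul_left, expect_resample, Finset.prod_insert (hs.1.not_mem y), mul_assoc]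
  gcongr with i _
  split_ifs with hi
  · obtain ⟨j, hj⟩ := hi
    rw [show x i = j from hx _ hj, h.varWeight_insert hs hy hj]
    exact h.sum_varWeight_le hcons
  · rw [varWeight_insert_of_not_involves hi (hs.1.not_mem y)]

/-- A redrawn variable does not occur in `τ` and contributes the factor 1 before and after. This
serves the case in which the resampled set is not added to the diagram. -/
theorem Pieces.expect_resample_weight_of_disjoint {Y : Finset (Elem A)}
    (hY : ∀ z ∈ τ, ¬ Overlap Y (D.el z.2)) :
    expect (resample p Y x) (D.weight p τ) = D.weight p τ x := by
  classical
  unfold Pieces.weight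
  rw [expect_mul_left, expect_resample]
  congr 1
  refine Finset.prod_congr rfl fun i _ => ?_
  split_ifs with hi
  · have : ∀ z ∈ τ, ¬ Involves (D.el z.2) i := fun z hz hzi => hY z hz ⟨i, hi, hzi⟩
    have hp : ∑ a, p i a = 1 := by rw [← (p i).tsum_coe, tsum_fintype]
    simp only [varWeight_of_not_involves this, mul_one, hp]
  · rfl

open Classical in
theorem Pieces.weight_root (hx : Holds (D.el r) x) : D.weight p {([], r)} x = D.q r := by
  unfold Pieces.weight
  rw [Finset.prod_singleton, Finset.prod_eq_one, mul_one]
  intro i _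
  rw [varWeight, Finset.prod_singleton]
  refine Finset.prod_eq_one fun j hj => ?_
  rw [if_neg, if_pos (hx _ (Finset.mem_filter.1 hj).2)]
  rintro ⟨z, hz, hlt, -⟩
  simp_all

theorem Pieces.q_le_potential (hx : Holds (D.el r) x) : D.q r ≤ D.potential p r x := by
  rw [← weight_root (p := p) hx]
  exact ENNReal.le_tsum (⟨_, Reach.root⟩ : {τ : Diagram ι N // D.Reach r τ})

end Weight

/-! ### The potential does not increase in a round -/

section Step

variable {ι : Type u} [Fintype ι] [DecidableEq ι] {A : ι → Type v} [∀ i, Fintype (A i)]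
  {N : Type w} [Fintype N] {D : Pieces A N} {p : ∀ i, PMF (A i)} {r : N} {x : Config A}

open Classical in
/-- The weight of a diagram dominates the contributions of all the ways in which it can arise by
one round of resampling in which the node `y` is resampled with probability `s y`. -/
theorem Pieces.fibre_le (hcons : ∀ y, D.ok y → Consistent (D.el y)) (hr : Consistent (D.el r))
    {s : N → ℝ≥0∞} (hsum : ∑ y, s y ≤ 1) (hs : ∀ y, s y ≤ D.q y)
    (hC : ∀ y, s y ≠ 0 → D.ok y ∧ Holds (D.el y) x)
    (hdep : ∀ y y', s y ≠ 0 → s y' ≠ 0 → D.Dep y y') (τ : Diagram ι N) :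
    (∑' τ' : {τ : Diagram ι N // D.Reach r τ}, ∑ y, if D.graft τ'.1 y = τ then
        s y * expect (resample p (D.el y) x) (D.weight p τ'.1) else 0)
      + (if τ = {([], r)} then s r else 0) ≤ D.weight p τ x := by
  -- If `τ` arises by a genuine addition, exactly one pair of diagram and node contributes.
  -- Otherwise `τ` can only come from itself, through nodes that find no place in it.
  by_cases hA : ∃ (τ₀ : {τ : Diagram ι N // D.Reach r τ}) (y₀ : N), s y₀ ≠ 0 ∧
      (∃ π, D.Vacant τ₀.1 y₀ π) ∧ D.graft τ₀.1 y₀ = τ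
  · obtain ⟨⟨τ₀, h₀⟩, y₀, hy₀, hv₀, hg₀⟩ := hA
    change ∃ π, D.Vacant τ₀ y₀ π at hv₀
    change D.graft τ₀ y₀ = τ at hg₀
    obtain ⟨π₀, hs₀, hg₀'⟩ := exists_graft_eq hv₀
    rw [hg₀, eq_comm] at hg₀'
    have huniq : ∀ (τ' : {τ : Diagram ι N // D.Reach r τ}) (y : N), s y ≠ 0 →
        D.graft τ'.1 y = τ → y = y₀ ∧ τ'.1 = τ₀ := by
      rintro ⟨τ', h'⟩ y hy hg
      by_cases hv : ∃ π, D.Vacant τ' y π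
      · obtain ⟨π, hs', hπ⟩ := exists_graft_eq hv
        exact h'.site_unique h₀ hs' hs₀ (hdep _ _ hy hy₀) (hdep _ _ hy₀ hy)
          (hπ.symm.trans (hg.trans hg₀'.symm))
      -- If `y` found no place in `τ'`, then `τ'` would be `τ`, where `y₀` sits at a leaf; but `y`
      -- depends on `y₀` and fits below it.
      · exfalso
        have hττ : insert (π₀, y₀) τ₀ = τ' := by
          rw [hg₀', ← hg]
          exact graft_eq_self hv
        have hleaf : ∀ t u, (π₀ ++ [t], u) ∉ τ' := by
          rw [← hττ]
          exact h₀.leaf_of_site hs₀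
        obtain ⟨t, ht⟩ := exists_vacant_of_leaf (hττ ▸ Finset.mem_insert_self (π₀, y₀) τ₀) hleaf
          (hC y hy).1 (hdep _ _ hy hy₀)
        exact hv ⟨_, ht⟩
    have hroot : τ ≠ {([], r)} := by
      intro h
      have : (π₀, y₀) ∈ ({([], r)} : Diagram ι N) := h ▸ hg₀' ▸ Finset.mem_insert_self _ _
      exact hs₀.1.ne_nil (Prod.ext_iff.1 (Finset.mem_singleton.1 this)).1
    rw [if_neg hroot, add_zero, tsum_eq_single ⟨τ₀, h₀⟩, Finset.sum_eq_single y₀, if_pos hg₀]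
    · refine (mul_le_mul_left (hs y₀) _).trans ?_
      rw [← hg₀']
      exact h₀.expect_resample_weight_le hs₀ (h₀.consistent hcons hr) (hcons _ (hC y₀ hy₀).1)
        (hC y₀ hy₀).2
    · intro y _ hne
      by_cases hy : s y = 0
      · simp [hy]
      · exact if_neg fun hg => hne (huniq ⟨τ₀, h₀⟩ y hy hg).1
    · simp
    · intro τ' hne
      refine Finset.sum_eq_zero fun y _ => ?_
      by_cases hy : s y = 0
      · simp [hy]
      · exact if_neg fun hg => hne (Subtype.ext (huniq τ' y hy hg).2)
  · push Not at hA
    have hself : ∀ (τ' : {τ : Diagram ι N // D.Reach r τ}) (y : N), s y ≠ 0 →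
        D.graft τ'.1 y = τ → τ'.1 = τ ∧ ¬ ∃ π, D.Vacant τ'.1 y π := by
      intro τ' y hy hg
      have hv : ¬ ∃ π, D.Vacant τ'.1 y π := fun hv => hA τ' y hy hv hg
      exact ⟨by rw [← hg, graft_eq_self hv], hv⟩
    have hle : (∑' τ' : {τ : Diagram ι N // D.Reach r τ}, ∑ y, if D.graft τ'.1 y = τ then
        s y * expect (resample p (D.el y) x) (D.weight p τ'.1) else 0) ≤ D.weight p τ x := by
      by_cases hτ : D.Reach r τ
      · rw [tsum_eq_single ⟨τ, hτ⟩]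
        · refine (Finset.sum_le_sum (g := fun y => s y * D.weight p τ x) fun y _ => ?_).trans ?_
          · split_ifs with hg
            · by_cases hy : s y = 0
              · simp [hy]
              -- A node that overlapped some node of `τ` would have a vacant path there.
              · rw [expect_resample_weight_of_disjoint]
                rintro ⟨π, v⟩ hz ⟨i, hyi, hvi⟩
                obtain ⟨π', hπ', -⟩ := hτ.exists_vacant_of_involves hz hvi (hC y hy).1 hyi
                exact (hself ⟨τ, hτ⟩ y hy hg).2 ⟨π', hπ'⟩
            · exact zero_le
          · rw [← Finset.sum_mul]
            exact mul_le_of_le_one_left zero_le hsum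
        · intro τ' hne
          refine Finset.sum_eq_zero fun y _ => ?_
          by_cases hy : s y = 0
          · simp [hy]
          · exact if_neg fun hg => hne (Subtype.ext (hself τ' y hy hg).1)
      · refine le_of_eq_of_le (ENNReal.tsum_eq_zero.2 fun τ' => Finset.sum_eq_zero fun y _ => ?_)
          zero_le
        exact if_neg fun hg : D.graft τ'.1 y = τ => hτ (hg ▸ τ'.2.reach_graft y)
    -- If the root can be resampled now, every selectable node depends on it and fits below the bare
    -- root. So no other term lands on this diagram, and its weight `q r` is left to pay for `s r`.
    by_cases hroot : τ = {([], r)} ∧ s r ≠ 0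
    · obtain ⟨rfl, hsr⟩ := hroot
      rw [if_pos rfl, ENNReal.tsum_eq_zero.2, zero_add, weight_root (hC r hsr).2]
      · exact hs r
      · intro τ'
        refine Finset.sum_eq_zero fun y _ => ?_
        by_cases hy : s y = 0
        · simp [hy]
        · refine if_neg fun hg => ?_
          obtain ⟨h1, h2⟩ := hself τ' y hy hg
          obtain ⟨t, ht⟩ := exists_vacant_of_leaf (D := D) (τ := τ'.1) (π := []) (v := r) (y := y)
            τ'.2.root_mem (fun t u hu => by rw [h1] at hu; simp at hu) (hC y hy).1 (hdep _ _ hy hsr)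
          exact h2 ⟨_, ht⟩
    · rw [show (if τ = {([], r)} then s r else 0) = 0 by grind, add_zero]
      exact hle

/-- One round of resampling does not increase the expectation of the potential; it decreases by the
probability that the root itself is resampled. -/
theorem Pieces.sum_expect_potential_le (hcons : ∀ y, D.ok y → Consistent (D.el y))
    (hr : Consistent (D.el r)) {s : N → ℝ≥0∞} (hsum : ∑ y, s y ≤ 1) (hs : ∀ y, s y ≤ D.q y)
    (hC : ∀ y, s y ≠ 0 → D.ok y ∧ Holds (D.el y) x)
    (hdep : ∀ y y', s y ≠ 0 → s y' ≠ 0 → D.Dep y y') :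
    (∑ y, s y * expect (resample p (D.el y) x) (D.potential p r)) + s r
      ≤ D.potential p r x := by
  classical
  calc
    _ = (∑' τ' : {τ : Diagram ι N // D.Reach r τ}, ∑ y,
          s y * expect (resample p (D.el y) x) (D.weight p τ'.1)) + s r := by
      unfold Pieces.potential
      simp only [expect_tsum, ← ENNReal.tsum_mul_left]
      rw [Summable.tsum_finsetSum fun _ _ => ENNReal.summable]
    -- Every pair `(τ', y)` lies in exactly one fibre of `graft`.
    _ = ∑' τ : {τ : Diagram ι N // D.Reach r τ},
        ((∑' τ' : {τ : Diagram ι N // D.Reach r τ}, ∑ y, if D.graft τ'.1 y = τ.1 then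
          s y * expect (resample p (D.el y) x) (D.weight p τ'.1) else 0)
        + (if τ.1 = {([], r)} then s r else 0)) := by
      rw [ENNReal.tsum_add]
      congr 1
      · rw [ENNReal.tsum_comm]
        refine tsum_congr fun τ' => ?_
        rw [Summable.tsum_finsetSum fun _ _ => ENNReal.summable]
        refine Finset.sum_congr rfl fun y _ => ?_
        rw [tsum_eq_single ⟨D.graft τ'.1 y, τ'.2.reach_graft y⟩, if_pos rfl]
        intro τ hne
        exact if_neg fun hg => hne (Subtype.ext hg.symm)
      · rw [tsum_eq_single ⟨{([], r)}, Reach.root⟩, if_pos rfl]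
        intro τ hne
        exact if_neg fun hg => hne (Subtype.ext hg)
    _ ≤ _ := ENNReal.tsum_le_tsum fun τ => fibre_le hcons hr hsum hs hC hdep τ.1

end Step

/-! ### Summing products of node weights over tree-like diagrams -/

section Counting

variable {ι : Type u} {A : ι → Type v} {N : Type w} {D : Pieces A N} {r : N} {τ : Diagram ι N}

/-- The diagram in the slot `s` of the root. -/
noncomputable def Diagram.sub (τ : Diagram ι N) (s : Option ι) : Diagram ι N :=
  τ.preimage (fun z => (s :: z.1, z.2)) fun a _ b _ h => by
    simpa [Prod.ext_iff] using h

@[simp]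
theorem Diagram.mem_sub {τ : Diagram ι N} {s : Option ι} {z : List (Option ι) × N} :
    z ∈ Diagram.sub τ s ↔ (s :: z.1, z.2) ∈ τ := Finset.mem_preimage

/-- `τ` is a tree-like diagram with root `r`. -/
structure Pieces.Tree (D : Pieces A N) (r : N) (τ : Diagram ι N) : Prop where
  root_mem : ([], r) ∈ τ
  unique : ∀ π v u, (π, v) ∈ τ → (π, u) ∈ τ → v = u
  parent : ∀ π s y, (π ++ [s], y) ∈ τ → ∃ v, (π, v) ∈ τ ∧ D.Fits s v y

/-- This forgets the order of the additions; what remains is inherited by the part of a diagram in a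
slot of its root, as the recursion requires. -/
theorem Pieces.Reach.tree (h : D.Reach r τ) : D.Tree r τ :=
  ⟨h.root_mem, fun _ _ _ => h.unique, fun _ _ _ => h.parent⟩

theorem Pieces.Tree.prefix_mem (h : D.Tree r τ) {π π' : List (Option ι)} {v : N}
    (hv : (π ++ π', v) ∈ τ) : ∃ u, (π, u) ∈ τ := by
  induction π' using List.reverseRecOn generalizing v with
  | nil => exact ⟨v, by simpa using hv⟩
  | append_singleton l s ih =>
    rw [← List.append_assoc] at hv
    obtain ⟨u, hu, -⟩ := h.parent _ _ _ hv
    exact ih hu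

theorem Pieces.Tree.sub (h : D.Tree r τ) {s : Option ι} {y : N} (hy : ([s], y) ∈ τ) :
    D.Fits s r y ∧ D.Tree y (Diagram.sub τ s) := by
  obtain ⟨v, hv, hf⟩ := h.parent [] s y hy
  refine ⟨h.unique _ _ _ hv h.root_mem ▸ hf, by simpa using hy, fun π v u hv hu => ?_,
    fun π t y hy => ?_⟩
  · exact h.unique _ _ _ (Diagram.mem_sub.1 hv) (Diagram.mem_sub.1 hu)
  · obtain ⟨v, hv, hf⟩ := h.parent (s :: π) t y (by simpa using hy)
    exact ⟨v, by simpa using hv, hf⟩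

variable [Fintype ι]

open Classical in
/-- The diagram with root `r` and the diagram `f s` in the slot `s` of the root. -/
noncomputable def Diagram.join (r : N) (f : Option ι → Diagram ι N) : Diagram ι N :=
  insert ([], r) (Finset.univ.biUnion fun s => (f s).image fun z => (s :: z.1, z.2))

theorem Diagram.mem_join_nil {f : Option ι → Diagram ι N} {v : N} :
    ([], v) ∈ Diagram.join r f ↔ v = r := by
  simp [Diagram.join]

theorem Diagram.mem_join_cons {f : Option ι → Diagram ι N} {v : N} {s : Option ι}
    {π : List (Option ι)} : (s :: π, v) ∈ Diagram.join r f ↔ (π, v) ∈ f s := by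
  simp [Diagram.join]

theorem Diagram.prod_join (f : Option ι → Diagram ι N) (w : N → ℝ≥0∞) :
    ∏ z ∈ Diagram.join r f, w z.2 = w r * ∏ s, ∏ z ∈ f s, w z.2 := by
  classical
  rw [Diagram.join, Finset.prod_insert (by simp), Finset.prod_biUnion]
  · congr 1
    refine Finset.prod_congr rfl fun s _ => ?_
    rw [Finset.prod_image]
    intro a _ b _ h
    simpa [Prod.ext_iff] using h
  · intro s _ s' _ hne
    simp only [Function.onFun, Finset.disjoint_left, Finset.mem_image]
    rintro _ ⟨z, -, rfl⟩ ⟨z', -, h⟩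
    simp only [Prod.mk.injEq, List.cons.injEq] at h
    exact hne h.1.1.symm

theorem Pieces.Tree.eq_join (h : D.Tree r τ) : τ = Diagram.join r (Diagram.sub τ) := by
  ext ⟨π, v⟩
  cases π with
  | nil =>
    rw [Diagram.mem_join_nil]
    exact ⟨fun hv => h.unique _ _ _ hv h.root_mem, fun hv => hv ▸ h.root_mem⟩
  | cons s π => rw [Diagram.mem_join_cons, Diagram.mem_sub]

variable [Fintype N]

open Classical in
/-- All tree-like diagrams with root `r` whose paths have length at most `n`. -/
noncomputable def Pieces.trees (D : Pieces A N) : ℕ → N → Finset (Diagram ι N)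
  | 0, r => {{([], r)}}
  | n + 1, r => (Fintype.piFinset fun s =>
      insert ∅ (({y | D.Fits s r y} : Finset N).biUnion (D.trees n))).image (Diagram.join r)

theorem Pieces.nil_mem_of_mem_trees (D : Pieces A N) {n : ℕ} (h : τ ∈ D.trees n r) :
    ([], r) ∈ τ := by
  classical
  cases n with
  | zero => simp_all [trees]
  | succ n =>
    rw [trees, Finset.mem_image] at h
    obtain ⟨f, -, rfl⟩ := h
    exact Diagram.mem_join_nil.2 rfl

theorem Pieces.Tree.mem_trees {n : ℕ} (h : D.Tree r τ) (hn : ∀ z ∈ τ, z.1.length ≤ n) :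
    τ ∈ D.trees n r := by
  classical
  induction n generalizing r τ with
  | zero =>
    rw [trees, Finset.mem_singleton, Finset.eq_singleton_iff_unique_mem]
    refine ⟨h.root_mem, fun ⟨π, v⟩ hz => ?_⟩
    have hπ : π = [] := List.length_eq_zero_iff.1 (Nat.le_zero.1 (hn _ hz))
    subst hπ
    rw [h.unique _ _ _ hz h.root_mem]
  | succ n ih =>
    rw [trees, Finset.mem_image]
    refine ⟨Diagram.sub τ, Fintype.mem_piFinset.2 fun s => ?_, h.eq_join.symm⟩
    by_cases hs : ∃ y, ([s], y) ∈ τ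
    · obtain ⟨y, hy⟩ := hs
      obtain ⟨hf, ht⟩ := h.sub hy
      refine Finset.mem_insert_of_mem (Finset.mem_biUnion.2 ⟨y, by simpa using hf, ih ht ?_⟩)
      intro z hz
      have := hn _ (Diagram.mem_sub.1 hz)
      simpa using this
    · refine Finset.mem_insert.2 (.inl (Finset.eq_empty_of_forall_notMem fun z hz => hs ?_))
      exact h.prefix_mem (π := [s]) (π' := z.1) (v := z.2) (by simpa using hz)

theorem sum_biUnion_le_sum {α β : Type*} [DecidableEq β] (s : Finset α) (t : α → Finset β)
    (f : β → ℝ≥0∞) :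
    ∑ b ∈ s.biUnion t, f b ≤ ∑ a ∈ s, ∑ b ∈ t a, f b := by
  classical
  induction s using Finset.induction_on with
  | empty => simp
  | insert a s ha ih =>
    rw [Finset.biUnion_insert, Finset.sum_insert ha]
    refine le_trans ?_ (add_le_add_right ih _)
    rw [← Finset.sum_union_inter]
    exact le_self_add

open Classical in
/-- A majorant for the total weight of the diagrams. -/
theorem Pieces.sum_trees_le {w μ : N → ℝ≥0∞}
    (hμ : ∀ r, w r * ∏ s, (1 + ∑ y with D.Fits s r y, μ y) ≤ μ r) (n : ℕ) (r : N) :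
    ∑ τ ∈ D.trees n r, ∏ z ∈ τ, w z.2 ≤ μ r := by
  have hw : ∀ r, w r ≤ μ r := fun r => le_trans (le_mul_of_one_le_right zero_le
    (Finset.one_le_prod' fun s _ => le_self_add)) (hμ r)
  induction n generalizing r with
  | zero => simpa [trees] using hw r
  | succ n ih =>
    refine le_trans ?_ (hμ r)
    rw [trees]
    calc
      _ ≤ ∑ f ∈ Fintype.piFinset fun s =>
            insert ∅ (({y | D.Fits s r y} : Finset N).biUnion (D.trees n)),
            ∏ z ∈ Diagram.join r f, w z.2 :=
        Finset.sum_image_le_of_nonneg (f := fun τ : Diagram ι N => ∏ z ∈ τ, w z.2)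
          fun _ _ => zero_le
      _ = w r * ∏ s, ∑ σ ∈ insert ∅ (({y | D.Fits s r y} : Finset N).biUnion (D.trees n)),
            ∏ z ∈ σ, w z.2 := by
        simp only [Diagram.prod_join]
        rw [← Finset.mul_sum, Finset.prod_univ_sum]
      _ ≤ _ := by
        gcongr with s _
        -- The empty diagram encodes a free slot and supplies the summand 1; it is separate because
        -- every tree contains its root.
        have h0 : ∅ ∉ ({y | D.Fits s r y} : Finset N).biUnion (D.trees n) := by
          simp only [Finset.mem_biUnion, not_exists, not_and]
          intro y _ hy
          simpa using D.nil_mem_of_mem_trees hy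
        rw [Finset.sum_insert h0, Finset.prod_empty]
        gcongr
        exact (sum_biUnion_le_sum _ _ _).trans (Finset.sum_le_sum fun y _ => ih y)

open Classical in
/-- A majorant for the total weight of the reachable diagrams. -/
theorem Pieces.tsum_reach_le {w μ : N → ℝ≥0∞}
    (hμ : ∀ r, w r * ∏ s, (1 + ∑ y with D.Fits s r y, μ y) ≤ μ r) (r : N) :
    ∑' τ : {τ : Diagram ι N // D.Reach r τ}, ∏ z ∈ τ.1, w z.2 ≤ μ r := by
  rw [ENNReal.tsum_eq_iSup_sum]
  refine iSup_le fun S => ?_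
  -- A finite family of diagrams has bounded depth.
  set n := S.sup fun τ => τ.1.sup fun z => z.1.length with hn
  refine le_trans ?_ (sum_trees_le hμ n r)
  refine (Finset.sum_map S (Function.Embedding.subtype _)
    (fun τ => ∏ z ∈ τ, w z.2)).symm.trans_le ?_
  refine Finset.sum_le_sum_of_subset fun τ hτ => ?_
  obtain ⟨σ, hσ, rfl⟩ := Finset.mem_map.1 hτ
  refine σ.2.tree.mem_trees fun z hz => ?_
  exact (Finset.le_sup (f := fun z : List (Option ι) × N => z.1.length) hz).trans
    (Finset.le_sup (f := fun τ : {τ : Diagram ι N // D.Reach r τ} =>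
      τ.1.sup fun z => z.1.length) hσ)

end Counting

/-! ### Potentials along an execution of the algorithm -/

section Algorithm

variable {ι : Type u} {A : ι → Type v} {K : ℕ}

/-- The pieces of an instance: a node is a set of elements together with a label; nodes without a
label are only used as roots. Below the root, the elements of `U` are not used. -/
noncomputable def Instance.pieces (I : Instance A K) (U : Set (Elem A)) :
    Pieces A (Option (Fin K) × Finset (Elem A)) where
  el y := y.2
  ok y := y.1.isSome ∧ Consistent y.2 ∧ ∀ e ∈ y.2, e ∉ U
  bow y v := ∃ k, y.1 = some k ∧ v.1 = some k ∧ I.Bowtie k y.2 v.2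
  q y := y.1.elim 1 fun k => ENNReal.ofReal (I.Q k y.2)

theorem Instance.pieces_consistent (I : Instance A K) (U : Set (Elem A))
    (y : Option (Fin K) × Finset (Elem A)) (h : (I.pieces U).ok y) :
    Consistent ((I.pieces U).el y) := h.2.1

theorem consistent_singleton (e : Elem A) : Consistent {e} := by
  intro i j j' hj hj'
  have := (Finset.mem_singleton.1 hj).trans (Finset.mem_singleton.1 hj').symm
  simpa using this

open Classical in
theorem Instance.selectPMF_apply [DecidableEq ι] [∀ i, DecidableEq (A i)]
    (I : Instance A K) (B : I.bad) (Y : Finset (Elem A)) :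
    I.selectPMF B Y = if Y ⊆ B.1 then
      ENNReal.ofReal (I.Q (I.label B) Y / ∑ Y' ∈ B.1.powerset, I.Q (I.label B) Y') else 0 := by
  rw [selectPMF, PMF.ofFinset_apply]
  congr

theorem Instance.selectPMF_le [DecidableEq ι] [∀ i, DecidableEq (A i)]
    (I : Instance A K) (B : I.bad) (Y : Finset (Elem A)) :
    I.selectPMF B Y ≤ ENNReal.ofReal (I.Q (I.label B) Y) := by
  rw [selectPMF_apply]
  split_ifs
  · exact ENNReal.ofReal_le_ofReal (div_le_self (I.Q_nonneg _ _) (I.Q_hitting B))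
  · exact zero_le

theorem Instance.subset_of_selectPMF_ne_zero [DecidableEq ι] [∀ i, DecidableEq (A i)]
    {I : Instance A K} {B : I.bad} {Y : Finset (Elem A)} (h : I.selectPMF B Y ≠ 0) : Y ⊆ B.1 := by
  by_contra hY
  exact h (by rw [selectPMF_apply, if_neg hY])

variable [Fintype ι] [DecidableEq ι] [∀ i, Fintype (A i)]

/-- The elements of the variable `i` with values in `J`. -/
def valueSet (i : ι) (J : Finset (A i)) : Set (Elem A) := {e | ∃ j ∈ J, e = ⟨i, j⟩}

/-- The potential for the event that the variable `i` takes a value in `J`. -/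
noncomputable def Instance.valuePotential (I : Instance A K) (p : ∀ i, PMF (A i)) (i : ι)
    (J : Finset (A i)) (x : Config A) : ℝ≥0∞ :=
  ∑ j ∈ J, (I.pieces (valueSet i J)).potential p (none, {⟨i, j⟩}) x

theorem Instance.one_le_valuePotential (I : Instance A K) (p : ∀ i, PMF (A i)) {i : ι}
    {J : Finset (A i)} {x : Config A} (hx : x i ∈ J) : 1 ≤ I.valuePotential p i J x := by
  refine le_trans ?_ (Finset.single_le_sum (fun _ _ => zero_le) hx)
  refine le_of_eq_of_le ?_ (Pieces.q_le_potential ?_)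
  · simp [pieces]
  · intro e he
    rw [show e = ⟨i, x i⟩ from Finset.mem_singleton.1 he]

theorem Instance.expect_next_of_running {I : Instance A K} {p : ∀ i, PMF (A i)} {σ : I.Strategy}
    {h : History A} (hr : I.Running h) (f : Config A → ℝ≥0∞) :
    expect (I.next p σ h) (fun h' => f h'.current) =
      expect (σ h hr) fun B => expect (I.selectPMF B.1) fun Y =>
        expect (resample p Y h.current) f := by
  rw [next, dif_pos hr, expect_bind]
  simp only [expect_bind, expect_map]
  rfl

theorem Instance.expect_next_of_not_running {I : Instance A K} {p : ∀ i, PMF (A i)}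
    {σ : I.Strategy} {h : History A} (hr : ¬ I.Running h) (f : History A → ℝ≥0∞) :
    expect (I.next p σ h) f = f h := by
  rw [next, dif_neg hr, expect_pure]

theorem Instance.expect_run_zero (I : Instance A K) (p : ∀ i, PMF (A i)) (σ : I.Strategy)
    (f : Config A → ℝ≥0∞) :
    expect (I.run p σ 0) (fun h => f h.current) = expect (productPMF p) f := by
  rw [run, expect_map]
  rfl

variable [∀ i, DecidableEq (A i)]

/-- One round with the bad-event `B`. -/
theorem Instance.round_le (I : Instance A K) {U : Set (Elem A)} (p : ∀ i, PMF (A i))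
    {x : Config A} (B : I.bad) (hB : Holds B.1 x) (hU : ∀ e ∈ B.1, e ∉ U)
    (r : Option (Fin K) × Finset (Elem A)) (hr : Consistent r.2) :
    expect (I.selectPMF B) (fun Y => expect (resample p Y x) ((I.pieces U).potential p r))
      + (if r.1 = some (I.label B) then I.selectPMF B r.2 else 0)
      ≤ (I.pieces U).potential p r x := by
  classical
  have key : ∀ f : Finset (Elem A) → ℝ≥0∞,
      ∑ y : Option (Fin K) × Finset (Elem A),
        (if y.1 = some (I.label B) then I.selectPMF B y.2 else 0) * f y.2 =
      expect (I.selectPMF B) f := by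
    intro f
    rw [expect, tsum_fintype, Fintype.sum_prod_type_right]
    refine Finset.sum_congr rfl fun Y _ => ?_
    simp
  have hsub : ∀ y : Option (Fin K) × Finset (Elem A),
      (if y.1 = some (I.label B) then I.selectPMF B y.2 else 0) ≠ 0 →
      y.1 = some (I.label B) ∧ y.2 ⊆ B.1 := by
    intro y hy
    split_ifs at hy with h
    · exact ⟨h, subset_of_selectPMF_ne_zero hy⟩
    · exact absurd rfl hy
  have h := Pieces.sum_expect_potential_le (D := I.pieces U) (p := p) (r := r) (x := x)
    (s := fun y => if y.1 = some (I.label B) then I.selectPMF B y.2 else 0)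
    (I.pieces_consistent U) hr ?_ ?_ ?_ ?_
  · rwa [← key]
  · have := key fun _ => 1
    simp only [mul_one] at this
    rw [this, expect_const]
  · intro y
    split_ifs with hy
    · simpa [pieces, hy] using I.selectPMF_le B y.2
    · exact zero_le
  · intro y hy
    obtain ⟨h1, h2⟩ := hsub y hy
    exact ⟨⟨by simp [h1], fun i j j' hj hj' => I.bad_consistent _ B.2 i j j' (h2 hj) (h2 hj'),
      fun e he => hU e (h2 he)⟩, fun e he => hB e (h2 he)⟩
  · intro y y' hy hy'
    obtain ⟨h1, h2⟩ := hsub y hy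
    obtain ⟨h1', h2'⟩ := hsub y' hy'
    -- Non-overlapping subsets of `B` are ⋈-related, with `B` itself as witness.
    by_cases ho : Overlap y.2 y'.2
    · exact .inl ho
    · exact .inr ⟨_, h1, h1', ho, B, rfl, h2, h2'⟩

/-- Once the value of `i` is in `J` the potential is at least 1, and the truncation at 1 gives the
bound for free. Before that, a true bad-event contains no element of `valueSet i J`, so `round_le`
applies. -/
theorem Instance.expect_next_valuePotential_le (I : Instance A K) (p : ∀ i, PMF (A i))
    (σ : I.Strategy) (i : ι) (J : Finset (A i)) (h : History A) :
    expect (I.next p σ h) (fun h' => min 1 (I.valuePotential p i J h'.current))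
      ≤ min 1 (I.valuePotential p i J h.current) := by
  have hone : expect (I.next p σ h) (fun h' => min 1 (I.valuePotential p i J h'.current)) ≤ 1 :=
    (expect_mono fun _ _ => min_le_left _ _).trans_eq (expect_const _ 1)
  by_cases hr : I.Running h
  · by_cases hx : h.current i ∈ J
    · rwa [min_eq_left (I.one_le_valuePotential p hx)]
    · refine le_min hone ((expect_mono fun _ _ => min_le_right _ _).trans ?_)
      rw [expect_next_of_running hr]
      refine (expect_mono fun B _ => ?_).trans_eq (expect_const (σ h hr) _)
      rw [show I.valuePotential p i J = fun x => ∑ j ∈ J, (I.pieces (valueSet i J)).potential p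
        (none, {⟨i, j⟩}) x from rfl]
      simp only [expect_sum]
      refine Finset.sum_le_sum fun j hj => le_trans le_self_add
        (I.round_le p B.1 B.2 ?_ (none, {⟨i, j⟩}) (consistent_singleton _))
      rintro e he ⟨j', hj', rfl⟩
      exact hx (by rw [B.2 _ he]; exact hj')
  · rw [expect_next_of_not_running hr]

theorem Instance.outputProb_le (I : Instance A K) (p : ∀ i, PMF (A i)) (σ : I.Strategy) (i : ι)
    (J : Finset (A i)) :
    I.outputProb p σ {x | x i ∈ J} ≤
      ∑ j ∈ J, expect (productPMF p)
        ((I.pieces (valueSet i J)).potential p (none, {⟨i, j⟩})) := by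
  refine iSup_le fun t => ?_
  have h1 : expect (I.run p σ t) (fun h => min 1 (I.valuePotential p i J h.current)) ≤
      expect (productPMF p) (I.valuePotential p i J) := by
    induction t with
    | zero =>
      rw [I.expect_run_zero p σ fun x => min 1 (I.valuePotential p i J x)]
      exact expect_mono fun _ _ => min_le_right _ _
    | succ t ih =>
      rw [run, expect_bind]
      exact (expect_mono fun h _ => I.expect_next_valuePotential_le p σ i J h).trans ih
  rw [outputProbWithin, toOuterMeasure_eq_expect]
  refine le_trans (expect_mono fun h _ => ?_) (h1.trans_eq ?_)
  · by_cases hh : h ∈ {h | ¬ I.Running h ∧ h.current ∈ {x : Config A | x i ∈ J}}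
    · rw [Set.indicator_of_mem hh, min_eq_left (I.one_le_valuePotential p hh.2)]
      rfl
    · rw [Set.indicator_of_notMem hh]
      exact zero_le
  · unfold valuePotential
    rw [expect_sum]

open Classical in
/-- The potential for the number of rounds. -/
noncomputable def Instance.roundPotential (I : Instance A K) (p : ∀ i, PMF (A i))
    (x : Config A) : ℝ≥0∞ :=
  ∑ r with (I.pieces ∅).ok r, (I.pieces ∅).potential p r x

/-- Summing `round_le` over all admissible roots, the decreases add up to the total probability 1 of
the selection. -/
theorem Instance.expect_next_roundPotential_le (I : Instance A K) (p : ∀ i, PMF (A i))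
    (σ : I.Strategy) (h : History A) :
    expect (I.next p σ h) (fun h' => I.roundPotential p h'.current)
      + {h | I.Running h}.indicator 1 h ≤ I.roundPotential p h.current := by
  classical
  by_cases hr : I.Running h
  · rw [expect_next_of_running hr, Set.indicator_of_mem (by exact hr), Pi.one_apply,
      ← expect_const (σ h hr) 1, ← expect_add]
    refine (expect_mono fun B _ => ?_).trans_eq (expect_const (σ h hr) _)
    have h1 : (1 : ℝ≥0∞) ≤ ∑ r with (I.pieces ∅).ok r,
        if r.1 = some (I.label B.1) then I.selectPMF B.1 r.2 else 0 := by
      rw [← (I.selectPMF B.1).tsum_coe, tsum_fintype, Finset.sum_filter,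
        Fintype.sum_prod_type_right]
      refine Finset.sum_le_sum fun Y _ => ?_
      refine le_trans ?_ (Finset.single_le_sum (fun _ _ => zero_le)
        (Finset.mem_univ (some (I.label B.1))))
      by_cases hY : I.selectPMF B.1 Y = 0
      · rw [hY]
        exact zero_le
      · have hsub := subset_of_selectPMF_ne_zero hY
        rw [if_pos, if_pos rfl]
        exact ⟨rfl, fun i j j' hj hj' => I.bad_consistent _ B.1.2 i j j' (hsub hj) (hsub hj'),
          fun _ _ => Set.notMem_empty _⟩
    refine (add_le_add_right h1 _).trans ?_
    rw [show I.roundPotential p = fun x => ∑ r with (I.pieces ∅).ok r,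
      (I.pieces ∅).potential p r x from rfl]
    simp only [expect_sum]
    rw [← Finset.sum_add_distrib]
    refine Finset.sum_le_sum fun r hr' => I.round_le p B.1 B.2 (fun _ _ => Set.notMem_empty _) r ?_
    exact (Finset.mem_filter.1 hr').2.2.1
  · rw [expect_next_of_not_running hr, Set.indicator_of_notMem (by exact hr), add_zero]

theorem Instance.tsum_running_le (I : Instance A K) (p : ∀ i, PMF (A i)) (σ : I.Strategy) :
    ∑' t, (I.run p σ t).toOuterMeasure {h | I.Running h} ≤
      expect (productPMF p) (I.roundPotential p) := by
  rw [ENNReal.tsum_eq_iSup_nat]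
  -- Strengthened for the induction: expected potential after `n` rounds plus expected number of
  -- rounds so far.
  refine iSup_le fun n => le_trans (le_add_left le_rfl)
    (?_ : expect (I.run p σ n) (fun h => I.roundPotential p h.current) +
      ∑ t ∈ Finset.range n, (I.run p σ t).toOuterMeasure {h | I.Running h} ≤ _)
  induction n with
  | zero => simp [I.expect_run_zero p σ (I.roundPotential p)]
  | succ n ih =>
    refine le_trans (le_of_eq_of_le ?_ (add_le_add_left (expect_mono (μ := I.run p σ n) fun h _ =>
      I.expect_next_roundPotential_le p σ h) _)) ih
    rw [expect_add, ← toOuterMeasure_eq_expect, Finset.sum_range_succ, run, expect_bind, add_assoc,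
      add_comm (∑ t ∈ Finset.range n, _)]

/-- If the expected number of rounds is finite, the algorithm terminates almost surely. -/
theorem Instance.one_le_outputProb_add (I : Instance A K) (p : ∀ i, PMF (A i)) (σ : I.Strategy)
    (hfin : expect (productPMF p) (I.roundPotential p) ≠ ⊤) (E : Set (Config A)) :
    1 ≤ I.outputProb p σ E + I.outputProb p σ Eᶜ := by
  have h0 := ENNReal.tendsto_atTop_zero_of_tsum_ne_top
    (ne_top_of_le_ne_top hfin (I.tsum_running_le p σ))
  have h1 := (tendsto_const_nhds (x := I.outputProb p σ E + I.outputProb p σ Eᶜ)).add h0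
  rw [add_zero] at h1
  refine ge_of_tendsto' h1 fun t => ?_
  refine le_trans ?_ (add_le_add_left (add_le_add
    (le_iSup (I.outputProbWithin p σ E) t) (le_iSup (I.outputProbWithin p σ Eᶜ) t)) _)
  simp only [outputProbWithin, toOuterMeasure_eq_expect, ← expect_add]
  refine (expect_const (I.run p σ t) 1).symm.trans_le (expect_mono fun h _ => ?_)
  by_cases hr : I.Running h
  · simp [hr]
  · by_cases hE : h.current ∈ E <;> simp [hr, hE]

end Algorithm

/-! ### A product form of the majorant -/

section Majorant

variable {ι : Type u} [Fintype ι] [DecidableEq ι] {A : ι → Type v}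
  {N : Type w} [Fintype N] {D : Pieces A N} {p : ∀ i, PMF (A i)}

open Classical in
-- The slot `none` costs at most `c r`; the slot `some i` costs at most `ρ i` if `r` involves `i`,
-- and nothing otherwise. Each factor is absorbed by `c` or by the factors `ρ` in `μ`.
theorem Pieces.weight_mul_prod_fits_le {ρ : ι → ℝ≥0∞} {c : N → ℝ≥0∞} {μ : N → ℝ≥0∞}
    (hμ : ∀ y, μ y = D.q y * (∏ e ∈ D.el y, p e.1 e.2 * ρ e.1) * c y)
    (hρ : ∀ i, 1 + ∑ y with D.ok y ∧ Involves (D.el y) i, μ y ≤ ρ i)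
    (hc : ∀ r, D.q r ≠ 0 → 1 + ∑ y with D.ok y ∧ D.bow y r, μ y ≤ c r) (r : N) :
    (D.q r * ∏ e ∈ D.el r, p e.1 e.2) * ∏ s, (1 + ∑ y with D.Fits s r y, μ y) ≤ μ r := by
  by_cases hq : D.q r = 0
  · simp [hq]
  rw [hμ, Fintype.prod_option, Finset.prod_mul_distrib, ← mul_assoc (D.q r), mul_assoc, mul_assoc,
    mul_assoc, mul_comm (∏ e ∈ D.el r, ρ e.1)]
  gcongr
  · exact (add_le_add_right (Finset.sum_le_sum_of_subset fun y hy => by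
      rw [Finset.mem_filter] at hy ⊢; exact hy) 1).trans (hc r hq)
  · rw [← Finset.prod_fiberwise (D.el r) Sigma.fst]
    refine Finset.prod_le_prod' fun i _ => ?_
    have h1 : ∀ i, 1 ≤ ρ i := fun i => le_self_add.trans (hρ i)
    by_cases hi : Involves (D.el r) i
    · obtain ⟨j, hj⟩ := hi
      calc
        _ ≤ ρ i := by
          refine le_trans ?_ (hρ i)
          gcongr with y
          exact fun h => ⟨h.1, h.2.2⟩
        _ ≤ _ := Finset.single_le_prod' (f := fun e : Elem A => ρ e.1)
          (s := {e ∈ D.el r | e.1 = i}) (a := ⟨i, j⟩) (fun e _ => h1 e.1)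
          (Finset.mem_filter.2 ⟨hj, rfl⟩)
    · rw [Finset.filter_false_of_mem fun y _ h => hi h.2.1, Finset.sum_empty, add_zero]
      exact Finset.one_le_prod' fun e _ => h1 e.1

variable [∀ i, Fintype (A i)]

open Classical in
theorem Pieces.expect_potential_le (hcons : ∀ y, D.ok y → Consistent (D.el y)) {r : N}
    (hr : Consistent (D.el r)) {μ : N → ℝ≥0∞}
    (hμ : ∀ r, (D.q r * ∏ e ∈ D.el r, p e.1 e.2) * ∏ s, (1 + ∑ y with D.Fits s r y, μ y) ≤ μ r) :
    expect (productPMF p) (D.potential p r) ≤ μ r := by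
  unfold Pieces.potential
  rw [expect_tsum]
  exact (ENNReal.tsum_le_tsum fun τ => τ.2.expect_weight_le (τ.2.consistent hcons hr)).trans
    (tsum_reach_le hμ r)

end Majorant

/-! ### The majorant in terms of λ, G and S -/

section Parameters

variable {ι : Type u} {A : ι → Type v} {K : ℕ} {I : Instance A K} {lam : ∀ i, A i → ℝ}

theorem lamPow_nonneg (hlam : ∀ i j, 0 ≤ lam i j) (Y : Finset (Elem A)) : 0 ≤ lamPow lam Y :=
  Finset.prod_nonneg fun e _ => hlam e.1 e.2

variable [∀ i, Fintype (A i)]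

/-- The weight of an element when the total weight of the variable `i` is reduced to `ρ i`. -/
noncomputable def rescale (lam : ∀ i, A i → ℝ) (ρ : ι → ℝ) (i : ι) (j : A i) : ℝ :=
  lam i j / lamSum lam i * ρ i

theorem lamSum_nonneg (hlam : ∀ i j, 0 ≤ lam i j) (i : ι) : 0 ≤ lamSum lam i :=
  Finset.sum_nonneg fun j _ => hlam i j

theorem rescale_nonneg (hlam : ∀ i j, 0 ≤ lam i j) {ρ : ι → ℝ} (hρ : ∀ i, 1 ≤ ρ i) (i : ι)
    (j : A i) : 0 ≤ rescale lam ρ i j :=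
  mul_nonneg (div_nonneg (hlam i j) (lamSum_nonneg hlam i)) (zero_le_one.trans (hρ i))

theorem rescale_le (hlam : ∀ i j, 0 ≤ lam i j) {ρ : ι → ℝ} (hρ : ∀ i, ρ i ≤ lamSum lam i)
    (i : ι) (j : A i) : rescale lam ρ i j ≤ lam i j := by
  refine (mul_le_mul_of_nonneg_left (hρ i)
    (div_nonneg (hlam i j) (lamSum_nonneg hlam i))).trans ?_
  by_cases h : lamSum lam i = 0
  · simpa [h] using hlam i j
  · rw [div_mul_cancel₀ _ h]

/-- The factor `ρ i / lamSum lam i` is kept at one element of `i` and given up elsewhere. This makes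
the condition on `ρ i` linear. -/
theorem lamPow_rescale_le (hlam : ∀ i j, 0 ≤ lam i j) {ρ : ι → ℝ} (h1 : ∀ i, 1 ≤ ρ i)
    (hle : ∀ i, ρ i ≤ lamSum lam i) {Y : Finset (Elem A)} {i : ι} (hi : Involves Y i) :
    lamPow (rescale lam ρ) Y ≤ ρ i / lamSum lam i * lamPow lam Y := by
  classical
  obtain ⟨j, hj⟩ := hi
  rw [lamPow, lamPow, ← Finset.mul_prod_erase _ _ hj, ← Finset.mul_prod_erase _ _ hj, ← mul_assoc]
  refine mul_le_mul (le_of_eq (by simp only [rescale]; ring)) (Finset.prod_le_prod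
    (fun e _ => rescale_nonneg hlam h1 e.1 e.2) fun e _ => rescale_le hlam hle e.1 e.2)
    (Finset.prod_nonneg fun e _ => rescale_nonneg hlam h1 e.1 e.2)
    (mul_nonneg (div_nonneg (zero_le_one.trans (h1 i)) (lamSum_nonneg hlam i)) (hlam i j))

variable [Fintype ι]

open Classical in
theorem Instance.le_S {k : Fin K} {Y : Finset (Elem A)} (hY : 0 < I.Q k Y) :
    ∑ Y' : Finset (Elem A) with I.Bowtie k Y' Y, I.Q k Y' * lamPow lam Y' ≤ I.S lam k :=
  le_ciSup (f := fun Y : {Y : Finset (Elem A) // 0 < I.Q k Y} =>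
    ∑ Y' : Finset (Elem A) with I.Bowtie k Y' Y.1, I.Q k Y' * lamPow lam Y')
    (Set.finite_range _).bddAbove ⟨Y, hY⟩

theorem Gvar_nonneg (hlam : ∀ i j, 0 ≤ lam i j) (k : Fin K) (i : ι) :
    0 ≤ Gvar (I.Q k) lam i :=
  Finset.sum_nonneg fun Y _ => mul_nonneg (I.Q_nonneg k Y) (lamPow_nonneg hlam Y)

theorem Instance.S_nonneg (hlam : ∀ i j, 0 ≤ lam i j) (k : Fin K) : 0 ≤ I.S lam k :=
  Real.iSup_nonneg fun _ => Finset.sum_nonneg fun Y _ =>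
    mul_nonneg (I.Q_nonneg k Y) (lamPow_nonneg hlam Y)

open Classical in
theorem Instance.S_le_Gtotal (hlam : ∀ i j, 0 ≤ lam i j) (k : Fin K) :
    I.S lam k ≤ Gtotal (I.Q k) lam := by
  have h := fun Y => mul_nonneg (I.Q_nonneg k Y) (lamPow_nonneg hlam Y)
  exact Real.iSup_le (fun Y => Finset.sum_le_sum_of_subset_of_nonneg (Finset.filter_subset _ _)
    fun Y _ _ => h Y) (Finset.sum_nonneg fun Y _ => h Y)

open Classical in
/-- Each form of the criterion implies the first one. -/
theorem Instance.Criterion.criterionS (hlam : ∀ i j, 0 ≤ lam i j) (h : I.Criterion lam) :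
    I.CriterionS lam := by
  rcases h with h | ⟨h1, h2⟩ | ⟨h1, h2⟩
  · exact h
  · refine ⟨fun k => (S_le_Gtotal hlam k).trans_lt (h1 k), fun i => le_trans ?_ (h2 i)⟩
    gcongr with k _
    · exact Gvar_nonneg hlam k i
    · linarith [h1 k]
    · exact S_le_Gtotal hlam k
  · have hS : ∀ k, I.S lam k = 0 := by
      refine fun k => le_antisymm (Real.iSup_le (fun Y => ?_) le_rfl) (S_nonneg hlam k)
      refine Finset.sum_nonpos fun Y' hY' => ?_
      have : ¬ 0 < I.Q k Y' := fun hpos => h1 k Y' Y.1 hpos Y.2 (Finset.mem_filter.1 hY').2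
      rw [le_antisymm (not_lt.1 this) (I.Q_nonneg k Y'), zero_mul]
    exact ⟨fun k => by simp [hS], fun i => by simpa [hS] using h2 i⟩

variable [DecidableEq ι] [∀ i, DecidableEq (A i)]

open Classical in
theorem Instance.sum_ok (I : Instance A K) (U : Set (Elem A))
    (P : Option (Fin K) × Finset (Elem A) → Prop)
    (f : Option (Fin K) × Finset (Elem A) → ℝ≥0∞) :
    ∑ y with (I.pieces U).ok y ∧ P y, f y = ∑ k : Fin K, ∑ Y : Finset (Elem A) with
      (Consistent Y ∧ ∀ e ∈ Y, e ∉ U) ∧ P (some k, Y), f (some k, Y) := by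
  simp only [Finset.sum_filter]
  rw [Fintype.sum_prod_type, Fintype.sum_option]
  simp [pieces]

open Classical in
/-- A bound for the potentials in terms of the parameters. -/
theorem Instance.expect_potential_le (hlam : ∀ i j, 0 ≤ lam i j) (hS : ∀ k, I.S lam k < 1)
    {p : ∀ i, PMF (A i)} (hp : ∀ i j, p i j = ENNReal.ofReal (lam i j / lamSum lam i))
    {U : Set (Elem A)} {ρ : ι → ℝ} (h1 : ∀ i, 1 ≤ ρ i) (hle : ∀ i, ρ i ≤ lamSum lam i)
    (hρ : ∀ i, 1 + ∑ k, (∑ Y : Finset (Elem A) with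
      (Consistent Y ∧ ∀ e ∈ Y, e ∉ U) ∧ Involves Y i, I.Q k Y * lamPow (rescale lam ρ) Y)
        / (1 - I.S lam k) ≤ ρ i)
    {r : Option (Fin K) × Finset (Elem A)} (hr : Consistent r.2) :
    expect (productPMF p) ((I.pieces U).potential p r) ≤
      ENNReal.ofReal (r.1.elim 1 (fun k => I.Q k r.2 / (1 - I.S lam k))
        * lamPow (rescale lam ρ) r.2) := by
  have hres := rescale_nonneg hlam h1
  have hS' : ∀ k, 0 < 1 - I.S lam k := fun k => sub_pos.2 (hS k)
  have hnn : ∀ k Y, 0 ≤ I.Q k Y * lamPow (rescale lam ρ) Y / (1 - I.S lam k) := fun k Y =>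
    div_nonneg (mul_nonneg (I.Q_nonneg k Y) (lamPow_nonneg hres Y)) (hS' k).le
  have hsome : ∀ k Y, ENNReal.ofReal ((some k : Option (Fin K)).elim 1
      (fun k => I.Q k Y / (1 - I.S lam k)) * lamPow (rescale lam ρ) Y) =
      ENNReal.ofReal (I.Q k Y * lamPow (rescale lam ρ) Y / (1 - I.S lam k)) := by
    intro k Y
    congr 1
    simp only [Option.elim_some]
    ring
  -- The choice `c = 1 / (1 - S)` solves `c = 1 + S * c`, which governs the slot `none`. Nothing is
  -- ⋈-related to an unlabelled root, so there `c = 1`.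
  refine Pieces.expect_potential_le (I.pieces_consistent U) hr
    (μ := fun r => ENNReal.ofReal (r.1.elim 1 (fun k => I.Q k r.2 / (1 - I.S lam k))
        * lamPow (rescale lam ρ) r.2))
    (Pieces.weight_mul_prod_fits_le (ρ := fun i => ENNReal.ofReal (ρ i))
      (c := fun r => ENNReal.ofReal (r.1.elim 1 fun k => (1 - I.S lam k)⁻¹)) ?_ ?_ ?_)
  · rintro ⟨o, Y⟩
    have hprod : ∏ e ∈ Y, p e.1 e.2 * ENNReal.ofReal (ρ e.1) =
        ENNReal.ofReal (lamPow (rescale lam ρ) Y) := by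
      rw [lamPow, ENNReal.ofReal_prod_of_nonneg fun e _ => hres e.1 e.2]
      refine Finset.prod_congr rfl fun e _ => ?_
      rw [hp, rescale, ENNReal.ofReal_mul (div_nonneg (hlam _ _) (lamSum_nonneg hlam _))]
    cases o with
    | none => simp [pieces, hprod]
    | some k =>
      simp only [pieces, hprod, Option.elim_some]
      rw [← ENNReal.ofReal_mul (I.Q_nonneg k Y),
        ← ENNReal.ofReal_mul (mul_nonneg (I.Q_nonneg k Y) (lamPow_nonneg hres Y))]
      congr 1
      ring
  · intro i
    rw [I.sum_ok U fun y => Involves ((I.pieces U).el y) i]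
    refine le_trans (le_of_eq ?_) (ENNReal.ofReal_le_ofReal (hρ i))
    rw [ENNReal.ofReal_add zero_le_one, ENNReal.ofReal_one, ENNReal.ofReal_sum_of_nonneg]
    · congr 1
      refine Finset.sum_congr rfl fun k _ => ?_
      rw [Finset.sum_div, ENNReal.ofReal_sum_of_nonneg fun Y _ => hnn k Y]
      exact Finset.sum_congr rfl fun Y _ => hsome k Y
    · intro k _
      rw [Finset.sum_div]
      exact Finset.sum_nonneg fun Y _ => hnn k Y
    · refine Finset.sum_nonneg fun k _ => ?_
      rw [Finset.sum_div]
      exact Finset.sum_nonneg fun Y _ => hnn k Y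
  · rintro ⟨o, Y⟩ hq
    cases o with
    | none => simp [pieces]
    | some k =>
      have hQ : 0 < I.Q k Y := by
        by_contra hQ
        exact hq (ENNReal.ofReal_eq_zero.2 (not_lt.1 hQ))
      have hsub : ∑ y with (I.pieces U).ok y ∧ (I.pieces U).bow y (some k, Y),
          ENNReal.ofReal (y.1.elim 1 (fun k => I.Q k y.2 / (1 - I.S lam k))
            * lamPow (rescale lam ρ) y.2) ≤
          ∑ Y' : Finset (Elem A) with I.Bowtie k Y' Y,
            ENNReal.ofReal (I.Q k Y' * lamPow lam Y' / (1 - I.S lam k)) := by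
        refine (Finset.sum_le_sum_of_subset (t := ({Y' | I.Bowtie k Y' Y} :
          Finset (Finset (Elem A))).map ⟨fun Y' => ((some k : Option (Fin K)), Y'),
            Prod.mk_right_injective _⟩) ?_).trans ?_
        · rintro ⟨o, Y'⟩ hy
          obtain ⟨-, k', rfl, hk, hb⟩ := (Finset.mem_filter.1 hy).2
          cases hk
          exact Finset.mem_map.2 ⟨Y', by simpa using hb, rfl⟩
        · rw [Finset.sum_map]
          refine Finset.sum_le_sum fun Y' _ => (hsome k Y').trans_le (ENNReal.ofReal_le_ofReal ?_)
          refine div_le_div_of_nonneg_right (mul_le_mul_of_nonneg_left ?_ (I.Q_nonneg k Y'))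
            (hS' k).le
          exact Finset.prod_le_prod (fun e _ => hres e.1 e.2)
            fun e _ => rescale_le hlam hle e.1 e.2
      refine (add_le_add_right hsub 1).trans ?_
      have hnn' : ∀ Y', 0 ≤ I.Q k Y' * lamPow lam Y' / (1 - I.S lam k) := fun Y' =>
        div_nonneg (mul_nonneg (I.Q_nonneg k Y') (lamPow_nonneg hlam Y')) (hS' k).le
      rw [← ENNReal.ofReal_sum_of_nonneg fun Y' _ => hnn' Y', ← ENNReal.ofReal_one,
        ← ENNReal.ofReal_add zero_le_one (Finset.sum_nonneg fun Y' _ => hnn' Y')]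
      refine ENNReal.ofReal_le_ofReal ?_
      rw [← Finset.sum_div, Option.elim_some, inv_eq_one_div, ← sub_nonneg,
        show 1 / (1 - I.S lam k) - (1 + (∑ Y' : Finset (Elem A) with I.Bowtie k Y' Y,
          I.Q k Y' * lamPow lam Y') / (1 - I.S lam k)) = (I.S lam k -
          ∑ Y' : Finset (Elem A) with I.Bowtie k Y' Y, I.Q k Y' * lamPow lam Y')
            / (1 - I.S lam k) by field_simp [(hS' k).ne']; ring]
      exact div_nonneg (sub_nonneg.2 (le_S hQ)) (hS' k).le

end Parameters

/-! ### Bounds for the output and finiteness of the number of rounds -/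

section Output

variable {ι : Type u} [Fintype ι] [DecidableEq ι] {A : ι → Type v} [∀ i, Fintype (A i)]
  [∀ i, DecidableEq (A i)] {K : ℕ} {I : Instance A K} {lam : ∀ i, A i → ℝ}

/-- A consistent set has at most one element at `i`, and `Q` vanishes on the other sets. -/
theorem Instance.sum_Gelem_le_Gvar (k : Fin K) (i : ι) :
    ∑ j, Gelem (I.Q k) lam i j ≤ Gvar (I.Q k) lam i := by
  classical
  simp only [Gelem, Gvar, Finset.sum_filter]
  rw [Finset.sum_comm]
  refine Finset.sum_le_sum fun Y _ => ?_
  rw [← Finset.sum_filter]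
  by_cases hY : Consistent Y
  · split_ifs with hi
    · obtain ⟨j, hj⟩ := hi
      rw [hY.filter_eq_singleton hj, Finset.sum_singleton]
    · rw [filter_eq_empty_of_not_involves hi, Finset.sum_empty]
  · simp [I.Q_consistent k Y hY]

theorem Instance.H_nonneg (hlam : ∀ i j, 0 ≤ lam i j) (hS : ∀ k, I.S lam k < 1) (i : ι)
    (j : A i) : 0 ≤ I.H lam i j :=
  Finset.sum_nonneg fun k _ => div_nonneg (Finset.sum_nonneg fun Y _ =>
    mul_nonneg (I.Q_nonneg k Y) (lamPow_nonneg hlam Y)) (sub_pos.2 (hS k)).le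

theorem Instance.CriterionS.one_add_Hsum_le (h : I.CriterionS lam) (i : ι) :
    1 + I.Hsum lam i ≤ lamSum lam i := by
  refine le_trans ?_ (h.2 i)
  simp only [Hsum, H]
  rw [Finset.sum_comm]
  gcongr with k _
  rw [← Finset.sum_div]
  exact div_le_div_of_nonneg_right (sum_Gelem_le_Gvar k i) (sub_pos.2 (h.1 k)).le

theorem Instance.CriterionS.one_le_lamSum (hlam : ∀ i j, 0 ≤ lam i j) (h : I.CriterionS lam)
    (i : ι) : 1 ≤ lamSum lam i :=
  le_trans (le_add_of_nonneg_right (Finset.sum_nonneg fun j _ => H_nonneg hlam h.1 i j))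
    (h.one_add_Hsum_le i)

open Classical in
theorem Instance.CriterionS.one_add_sum_le (hlam : ∀ i j, 0 ≤ lam i j) (h : I.CriterionS lam)
    (U : Set (Elem A)) {ρ : ι → ℝ} (h1 : ∀ i, 1 ≤ ρ i) (hle : ∀ i, ρ i ≤ lamSum lam i) (i : ι) :
    1 + ∑ k, (∑ Y : Finset (Elem A) with
      (Consistent Y ∧ ∀ e ∈ Y, e ∉ U) ∧ Involves Y i, I.Q k Y * lamPow (rescale lam ρ) Y)
        / (1 - I.S lam k) ≤ lamSum lam i := by
  refine le_trans ?_ (h.2 i)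
  gcongr with k _
  · exact (sub_pos.2 (h.1 k)).le
  · refine (Finset.sum_le_sum fun Y _ => mul_le_mul_of_nonneg_left (Finset.prod_le_prod
      (fun e _ => rescale_nonneg hlam h1 e.1 e.2) fun e _ => rescale_le hlam hle e.1 e.2)
      (I.Q_nonneg k Y)).trans ?_
    refine Finset.sum_le_sum_of_subset_of_nonneg ?_ fun Y _ _ =>
      mul_nonneg (I.Q_nonneg k Y) (lamPow_nonneg hlam Y)
    intro Y hY
    simp only [Finset.mem_filter] at hY ⊢
    exact ⟨hY.1, hY.2.2⟩

open Classical in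
-- A set that involves `i` but avoids the values in `J` contains some `(i, j)` with `j ∉ J`, so its
-- term is counted on the right.
theorem Instance.sum_avoiding_le (hlam : ∀ i j, 0 ≤ lam i j) {ρ : ι → ℝ} (h1 : ∀ i, 1 ≤ ρ i)
    (hle : ∀ i, ρ i ≤ lamSum lam i) (k : Fin K) (i : ι) (J : Finset (A i)) :
    ∑ Y : Finset (Elem A) with (Consistent Y ∧ ∀ e ∈ Y, e ∉ valueSet i J) ∧ Involves Y i,
      I.Q k Y * lamPow (rescale lam ρ) Y ≤
      ρ i / lamSum lam i * ∑ j ∈ Jᶜ, Gelem (I.Q k) lam i j := by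
  have hc : 0 ≤ ρ i / lamSum lam i := div_nonneg (zero_le_one.trans (h1 i)) (lamSum_nonneg hlam i)
  have hnn : ∀ Y, 0 ≤ I.Q k Y * lamPow lam Y := fun Y =>
    mul_nonneg (I.Q_nonneg k Y) (lamPow_nonneg hlam Y)
  simp only [Gelem, Finset.sum_filter]
  rw [Finset.sum_comm, Finset.mul_sum]
  refine Finset.sum_le_sum fun Y _ => ?_
  have hs : 0 ≤ ∑ j ∈ Jᶜ, if (⟨i, j⟩ : Elem A) ∈ Y then I.Q k Y * lamPow lam Y else 0 :=
    Finset.sum_nonneg fun j _ => by split_ifs; exacts [hnn Y, le_rfl]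
  split_ifs with hY
  · obtain ⟨⟨-, hU⟩, hi⟩ := hY
    obtain ⟨j, hj⟩ := id hi
    have hjJ : j ∈ Jᶜ := Finset.mem_compl.2 fun hjJ => hU _ hj ⟨j, hjJ, rfl⟩
    calc
      _ ≤ ρ i / lamSum lam i * (I.Q k Y * lamPow lam Y) := by
        rw [mul_left_comm]
        exact mul_le_mul_of_nonneg_left (lamPow_rescale_le hlam h1 hle hi) (I.Q_nonneg k Y)
      _ ≤ _ := by
        refine mul_le_mul_of_nonneg_left ?_ hc
        refine le_trans (le_of_eq ?_) (Finset.single_le_sum (f := fun j =>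
          if (⟨i, j⟩ : Elem A) ∈ Y then I.Q k Y * lamPow lam Y else 0) (fun j _ => ?_) hjJ)
        · exact (if_pos hj).symm
        · split_ifs; exacts [hnn Y, le_rfl]
  · exact mul_nonneg hc hs

/-- The upper bound for the probability that the variable `i` ends with a value in `J`. -/
theorem Instance.CriterionS.outputProb_le (hlam : ∀ i j, 0 ≤ lam i j) (h : I.CriterionS lam)
    {p : ∀ i, PMF (A i)} (hp : ∀ i j, p i j = ENNReal.ofReal (lam i j / lamSum lam i))
    (σ : I.Strategy) (i : ι) (J : Finset (A i)) :
    I.outputProb p σ {x | x i ∈ J} ≤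
      ENNReal.ofReal ((∑ j ∈ J, lam i j) / (lamSum lam i - ∑ j ∈ Jᶜ, I.H lam i j)) := by
  classical
  have hl := h.one_le_lamSum hlam
  set c := ∑ j ∈ Jᶜ, I.H lam i j with hc
  have hc0 : 0 ≤ c := Finset.sum_nonneg fun j _ => H_nonneg hlam h.1 i j
  have hc1 : 1 ≤ lamSum lam i - c := by
    have h1 : c ≤ I.Hsum lam i := Finset.sum_le_sum_of_subset_of_nonneg (Finset.subset_univ _)
      fun j _ _ => H_nonneg hlam h.1 i j
    have h2 := h.one_add_Hsum_le i
    linarith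
  have hpos : 0 < lamSum lam i := zero_lt_one.trans_le (hl i)
  -- At `i` this is the solution of `ρ = 1 + ρ / lamSum lam i * c`; the other variables keep their
  -- full weight. The bounds `0 ≤ c` and `1 ≤ lamSum lam i - c` place it between 1 and `lamSum lam
  -- i`.
  set ρ : ι → ℝ := Function.update (lamSum lam) i (lamSum lam i / (lamSum lam i - c)) with hρ
  have hρi : ρ i = lamSum lam i / (lamSum lam i - c) := Function.update_self ..
  have hρne : ∀ i', i' ≠ i → ρ i' = lamSum lam i' := fun i' hne => Function.update_of_ne hne ..
  have h1 : ∀ i', 1 ≤ ρ i' := by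
    intro i'
    by_cases hi' : i' = i
    · subst hi'
      rw [hρi, one_le_div (by linarith)]
      linarith
    · rw [hρne i' hi']
      exact hl i'
  have hle : ∀ i', ρ i' ≤ lamSum lam i' := by
    intro i'
    by_cases hi' : i' = i
    · subst hi'
      rw [hρi]
      exact div_le_self hpos.le hc1
    · rw [hρne i' hi']
  refine (I.outputProb_le p σ i J).trans ?_
  calc
    _ ≤ ∑ j ∈ J, ENNReal.ofReal (lam i j / (lamSum lam i - c)) := by
      refine Finset.sum_le_sum fun j _ => (expect_potential_le hlam h.1 hp h1 hle ?_
        (consistent_singleton _)).trans_eq ?_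
      · intro i'
        by_cases hi' : i' = i
        · subst hi'
          have : ∑ k, (∑ Y : Finset (Elem A) with (Consistent Y ∧ ∀ e ∈ Y, e ∉ valueSet i' J) ∧
              Involves Y i', I.Q k Y * lamPow (rescale lam ρ) Y) / (1 - I.S lam k) ≤
              ρ i' / lamSum lam i' * c := by
            rw [hc]
            simp only [H]
            rw [Finset.sum_comm, Finset.mul_sum]
            refine Finset.sum_le_sum fun k _ => ?_
            rw [← Finset.sum_div, ← mul_div_assoc]
            exact div_le_div_of_nonneg_right (sum_avoiding_le hlam h1 hle k i' J)
              (sub_pos.2 (h.1 k)).le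
          refine (add_le_add_right this 1).trans_eq ?_
          rw [hρi]
          field_simp [hpos.ne', (zero_lt_one.trans_le hc1).ne']
          ring
        · rw [hρne i' hi']
          exact h.one_add_sum_le hlam _ h1 hle i'
      · congr 1
        simp only [Option.elim_none, lamPow, Finset.prod_singleton, one_mul, rescale, hρi]
        field_simp
    _ = _ := by
      rw [Finset.sum_div, ENNReal.ofReal_sum_of_nonneg]
      exact fun j _ => div_nonneg (hlam i j) (zero_le_one.trans hc1)

open Classical in
theorem Instance.CriterionS.expect_roundPotential_ne_top (hlam : ∀ i j, 0 ≤ lam i j)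
    (h : I.CriterionS lam) {p : ∀ i, PMF (A i)}
    (hp : ∀ i j, p i j = ENNReal.ofReal (lam i j / lamSum lam i)) :
    expect (productPMF p) (I.roundPotential p) ≠ ⊤ := by
  unfold roundPotential
  rw [expect_sum]
  refine (ENNReal.sum_lt_top.2 fun r hr => ?_).ne
  have hl := h.one_le_lamSum hlam
  exact (expect_potential_le hlam h.1 hp hl (fun _ => le_rfl)
    (fun i => h.one_add_sum_le hlam _ hl (fun _ => le_rfl) i)
    (Finset.mem_filter.1 hr).2.2.1).trans_lt ENNReal.ofReal_lt_top

end Output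

end PRA

theorem theorem3p7 {ι : Type*} [Fintype ι] [DecidableEq ι] {A : ι → Type*}
    [∀ i, Fintype (A i)] [∀ i, DecidableEq (A i)] {K : ℕ}
    (I : PRA.Instance A K)
    (lam : ∀ i, A i → ℝ) (hlam : ∀ i j, 0 ≤ lam i j) (hcrit : I.Criterion lam)
    (p : ∀ i, PMF (A i))
    (hp : ∀ i j, p i j = ENNReal.ofReal (lam i j / PRA.lamSum lam i))
    (σ : I.Strategy) (i : ι) (J : Finset (A i)) :
    (I.outputProb p σ {x | x i ∈ J}).toReal
        ≤ (∑ j ∈ J, lam i j)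
          / (PRA.lamSum lam i - I.Hsum lam i + ∑ j ∈ J, I.H lam i j) ∧
      ((∑ j ∈ J, lam i j) - ∑ j ∈ J, I.H lam i j)
          / (PRA.lamSum lam i - ∑ j ∈ J, I.H lam i j)
        ≤ (I.outputProb p σ {x | x i ∈ J}).toReal := by
  have h := hcrit.criterionS hlam
  have hl := h.one_add_Hsum_le i
  have hH := fun j => PRA.Instance.H_nonneg hlam h.1 i j
  have hHs : ∑ j ∈ J, I.H lam i j + ∑ j ∈ Jᶜ, I.H lam i j = I.Hsum lam i :=
    Finset.sum_add_sum_compl J _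
  have hls : ∑ j ∈ J, lam i j + ∑ j ∈ Jᶜ, lam i j = PRA.lamSum lam i :=
    Finset.sum_add_sum_compl J _
  have hHJ : 0 ≤ ∑ j ∈ J, I.H lam i j := Finset.sum_nonneg fun j _ => hH j
  have hHJc : 0 ≤ ∑ j ∈ Jᶜ, I.H lam i j := Finset.sum_nonneg fun j _ => hH j
  have hlJ : 0 ≤ ∑ j ∈ J, lam i j := Finset.sum_nonneg fun j _ => hlam i j
  have hlJc : 0 ≤ ∑ j ∈ Jᶜ, lam i j := Finset.sum_nonneg fun j _ => hlam i j
  have h1 := h.outputProb_le hlam hp σ i J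
  have h2 := h.outputProb_le hlam hp σ i Jᶜ
  rw [compl_compl] at h2
  -- Almost sure termination turns the upper bound for `Jᶜ` into the lower bound for `J`.
  have h3 := I.one_le_outputProb_add p σ (h.expect_roundPotential_ne_top hlam hp) {x | x i ∈ J}
  have hc : ({x | x i ∈ J}ᶜ : Set (PRA.Config A)) = {x | x i ∈ Jᶜ} := by
    ext x
    simp
  rw [hc] at h3
  have h1' := ENNReal.toReal_le_of_le_ofReal (div_nonneg hlJ (by linarith)) h1
  have h2' := ENNReal.toReal_le_of_le_ofReal (div_nonneg hlJc (by linarith)) h2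
  have hne1 := ne_top_of_le_ne_top ENNReal.ofReal_ne_top h1
  have hne2 := ne_top_of_le_ne_top ENNReal.ofReal_ne_top h2
  have h3' := ENNReal.toReal_mono (ENNReal.add_ne_top.2 ⟨hne1, hne2⟩) h3
  rw [ENNReal.toReal_one, ENNReal.toReal_add hne1 hne2] at h3'
  constructor
  · rwa [show PRA.lamSum lam i - I.Hsum lam i + ∑ j ∈ J, I.H lam i j =
      PRA.lamSum lam i - ∑ j ∈ Jᶜ, I.H lam i j by linarith]
  · have hd : PRA.lamSum lam i - ∑ j ∈ J, I.H lam i j ≠ 0 := by linarith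
    have h4 : ((∑ j ∈ J, lam i j) - ∑ j ∈ J, I.H lam i j)
          / (PRA.lamSum lam i - ∑ j ∈ J, I.H lam i j) =
        1 - (∑ j ∈ Jᶜ, lam i j) / (PRA.lamSum lam i - ∑ j ∈ J, I.H lam i j) := by
      rw [eq_sub_iff_add_eq, ← add_div, div_eq_one_iff_eq hd]
      linarith
    rw [h4]
    linarith
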